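/- Alphabets are finite, and every output alphabet carries a linear (alphabetical) order. A (multi-valued partial) function is a map $f:\Sigma^*\to\mathcal P(\Gamma^*)$ for some alphabets $\Sigma,\Gamma$; it is single-valued if $|f(x)|\le 1$ and total if $f(x)\ne\emptyset$ for all $x$. An npda with output is a one-way nondeterministic pushdown automaton (input between endmarkers, $\lambda$-moves allowed, accepting and rejecting halting states) with a write-only output tape, on which at most one symbol is written per step, such that on every input $x$ all computation paths reach a halting state within $O(|x|)$ steps. Its valid outputs on $x$ are the strings produced along its accepting paths. $\mathrm{CFLSV_t}$ is the class of single-valued total functions $f$ such that, for some npda with output, $f(x)$ is the set of its valid outputs on $x$, for every $x$. $\mathrm{OptCFL}$ is the class of single-valued total functions $f$ for which there are an npda $M$ with output and an $opt\in\{\max,\min\}$ such that, for every $x$, $M$ has an accepting path on $x$ and $f(x)$ is the $opt$ of the valid outputs of $M$ on $x$, in the dictionary order of $\Gamma^*$ (in which a proper prefix of a string precedes it). An oracle npda has in addition a write-only query tape and states $q_{query},q_{yes},q_{no}$: when it enters $q_{query}$ with $s$ on the query tape, the query tape is blanked and the next state is $q_{yes}$ if $s$ is in the oracle and $q_{no}$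 otherwise; all its computation paths must reach a halting state in $O(|x|)$ steps no matter what oracle is used. $\mathrm{CFL}_T(\mathcal C)$ is the family of languages recognized by oracle npda's with an oracle in $\mathcal C$. Put $\Sigma_1^{\mathrm{CFL}}=\mathrm{CFL}$ (the context-free languages), let $\Pi_k^{\mathrm{CFL}}$ be the family of complements of languages in $\Sigma_k^{\mathrm{CFL}}$, and $\Sigma_{k+1}^{\mathrm{CFL}}=\mathrm{CFL}_T(\Pi_k^{\mathrm{CFL}})$. For $k\ge1$, $\Sigma_{k+1}^{\mathrm{CFL}}\mathrm{SV_t}$ is the class of single-valued total functions $f$ for which there is an oracle npda with an output tape and an oracle in $\Pi_k^{\mathrm{CFL}}$ such that $f(x)$ is the set of valid outputs on $x$, for every $x$. Then $$\mathrm{CFLSV_t}\subsetneq\mathrm{OptCFL}\subseteq\Sigma_4^{\mathrm{CFL}}\mathrm{SV_t}.$$ Moreover, the function $f(w)=\max g(w)$ (dictionary order, $0<1$) on $w\in\{0,1,\natural,\#\}^*$, where $$g(w)=\{\lambda\}\cup\{x_iy_i \mid w=x_1\natural x_2\natural x_3\# y_1\natural y_2\natural y_3,\ x_j,y_j\in\{0,1\}^*\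 (1\le j\le 3),\ x_i=y_i^R,\ i\in\{1,2,3\}\},$$ belongs to $\mathrm{OptCFL}$ but not to $\mathrm{CFLSV_t}$. -/

import Mathlib

/-! Pushdown transducers, oracle pushdown transducers, the CFL hierarchy and the function
classes built from them. -/

namespace CFLFun

/-- The input tape alphabet: an input alphabet together with the two endmarkers. -/
inductive Tape (S : Type) : Type
  | left : Tape S
  | sym : S → Tape S
  | right : Tape S

/-- The content of the input tape on input `x`: `x` between the two endmarkers. -/
def tapeOf {S : Type} (x : List S) : List (Tape S) :=
  Tape.left :: (x.map Tape.sym ++ [Tape.right])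

/-- `StepsIn r a n b`: there is an `r`-path of exactly `n` steps from `a` to `b`. -/
inductive StepsIn {α : Type} (r : α → α → Prop) (a : α) : ℕ → α → Prop
  | refl : StepsIn r a 0 a
  | tail {n : ℕ} {b c : α} : StepsIn r a n b → r b c → StepsIn r a (n + 1) c

/-! ### Npda's with a write-only output tape -/

/-- A one-way one-head nondeterministic pushdown automaton with input alphabet `S` and a
write-only output tape over `G`.  In `trans q a Z`, the value `a = none` is a `λ`-move of the input
head, `a = some σ` reads `σ` and moves on.  An element `(p, w, o)` of `trans q a Z` means: enter `p`,
replace the topmost stack symbol `Z` by the string `w`, write `o` (or nothing) on the output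
tape. Values of `trans` at halting states are never used. -/
structure NPDA (S G : Type) where
  /-- inner states -/
  Q : Type
  /-- stack alphabet -/
  Stk : Type
  finQ : Finite Q
  finStk : Finite Stk
  start : Q
  bottom : Stk
  acc : Set Q
  rej : Set Q
  disj : Disjoint acc rej
  trans : Q → Option (Tape S) → Stk → Set (Q × List Stk × Option G)
  finTrans : ∀ q a Z, (trans q a Z).Finite

namespace NPDA

variable {S G : Type}

/-- A configuration: inner state, unread part of the input tape, stack content (top first),
content of the output tape. -/
structure Config (M : NPDA S G) where
  state : M.Q
  input : List (Tape S)
  stack : List M.Stk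
  output : List G

def init (M : NPDA S G) (x : List S) : M.Config :=
  ⟨M.start, tapeOf x, [M.bottom], []⟩

/-- Halting states. -/
def halt (M : NPDA S G) : Set M.Q := M.acc ∪ M.rej

/-- One step of the machine. Halting configurations have no successors. -/
inductive Step (M : NPDA S G) : M.Config → M.Config → Prop
  | stay {q p : M.Q} {u : List (Tape S)} {Z : M.Stk} {v w : List M.Stk} {o : Option G}
      {y : List G} : q ∉ M.halt → (p, w, o) ∈ M.trans q none Z →
      Step M ⟨q, u, Z :: v, y⟩ ⟨p, u, w ++ v, y ++ o.toList⟩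
  | read {q p : M.Q} {a : Tape S} {u : List (Tape S)} {Z : M.Stk} {v w : List M.Stk}
      {o : Option G} {y : List G} : q ∉ M.halt → (p, w, o) ∈ M.trans q (some a) Z →
      Step M ⟨q, a :: u, Z :: v, y⟩ ⟨p, u, w ++ v, y ++ o.toList⟩

/-- The termination condition: on every input, every computation path reaches a halting state
within linearly many steps (so no path is longer than the bound, and none gets stuck
in a non-halting state). -/
def Terminates (M : NPDA S G) : Prop :=
  ∃ a b : ℕ, ∀ (x : List S) (n : ℕ) (c : M.Config), StepsIn M.Step (M.init x) n c →
    n ≤ a * x.length + b ∧ (c.state ∈ M.halt ∨ ∃ c', M.Step c c')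

/-- The valid outputs of `M` on `x`: those produced along accepting computation paths. -/
def outputs (M : NPDA S G) (x : List S) : Set (List G) :=
  {y | ∃ (n : ℕ) (c : M.Config), StepsIn M.Step (M.init x) n c ∧ c.state ∈ M.acc ∧ c.output = y}

end NPDA

/-! ### Oracle npda's -/

/-- An npda with input alphabet `S`, a write-only output tape over `G`, a write-only query tape over
`D`, and three extra states `query`, `yes`, `no`.  An element `(p, w, d, o)` of `trans q a Z` means:
enter `p`, replace `Z` by `w`, write `d` (or nothing) on the query tape and `o` (or
nothing) on the output tape.  Values of `trans` at halting states and at `query` are never used. -/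
structure OracleNPDA (S D G : Type) where
  /-- inner states -/
  Q : Type
  /-- stack alphabet -/
  Stk : Type
  finQ : Finite Q
  finStk : Finite Stk
  start : Q
  bottom : Stk
  acc : Set Q
  rej : Set Q
  disj : Disjoint acc rej
  query : Q
  yes : Q
  no : Q
  query_ne_yes : query ≠ yes
  query_ne_no : query ≠ no
  yes_ne_no : yes ≠ no
  query_notMem : query ∉ acc ∪ rej
  trans : Q → Option (Tape S) → Stk → Set (Q × List Stk × Option D × Option G)
  finTrans : ∀ q a Z, (trans q a Z).Finite

namespace OracleNPDA

variable {S D G : Type}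

/-- A configuration: inner state, unread part of the input tape, stack content (top first),
contents of the query tape and of the output tape. -/
structure Config (M : OracleNPDA S D G) where
  state : M.Q
  input : List (Tape S)
  stack : List M.Stk
  queryTape : List D
  output : List G

def init (M : OracleNPDA S D G) (x : List S) : M.Config :=
  ⟨M.start, tapeOf x, [M.bottom], [], []⟩

/-- Halting states. -/
def halt (M : OracleNPDA S D G) : Set M.Q := M.acc ∪ M.rej

/-- One step of the machine with oracle `A`. In the query state the only step is the oracle call,
which blanks the query tape and leads to `yes` or `no` according to the oracle's answer. -/
inductive Step (M : OracleNPDA S D G) (A : Language D) : M.Config → M.Config → Prop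
  | stay {q p : M.Q} {u : List (Tape S)} {Z : M.Stk} {v w : List M.Stk} {d : Option D}
      {o : Option G} {s : List D} {y : List G} : q ∉ M.halt → q ≠ M.query →
      (p, w, d, o) ∈ M.trans q none Z →
      Step M A ⟨q, u, Z :: v, s, y⟩ ⟨p, u, w ++ v, s ++ d.toList, y ++ o.toList⟩
  | read {q p : M.Q} {a : Tape S} {u : List (Tape S)} {Z : M.Stk} {v w : List M.Stk}
      {d : Option D} {o : Option G} {s : List D} {y : List G} : q ∉ M.halt → q ≠ M.query →
      (p, w, d, o) ∈ M.trans q (some a) Z →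
      Step M A ⟨q, a :: u, Z :: v, s, y⟩ ⟨p, u, w ++ v, s ++ d.toList, y ++ o.toList⟩
  | ask_yes {u : List (Tape S)} {v : List M.Stk} {s : List D} {y : List G} : s ∈ A →
      Step M A ⟨M.query, u, v, s, y⟩ ⟨M.yes, u, v, [], y⟩
  | ask_no {u : List (Tape S)} {v : List M.Stk} {s : List D} {y : List G} : s ∉ A →
      Step M A ⟨M.query, u, v, s, y⟩ ⟨M.no, u, v, [], y⟩

/-- The termination condition: every computation path reaches a halting state within linearly
many steps, no matter what oracle is used. -/
def Terminates (M : OracleNPDA S D G) : Prop :=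
  ∃ a b : ℕ, ∀ (A : Language D) (x : List S) (n : ℕ) (c : M.Config),
    StepsIn (M.Step A) (M.init x) n c →
      n ≤ a * x.length + b ∧ (c.state ∈ M.halt ∨ ∃ c', M.Step A c c')

/-- The valid outputs of `M` with oracle `A` on `x`. -/
def outputs (M : OracleNPDA S D G) (A : Language D) (x : List S) : Set (List G) :=
  {y | ∃ (n : ℕ) (c : M.Config),
    StepsIn (M.Step A) (M.init x) n c ∧ c.state ∈ M.acc ∧ c.output = y}

/-- `M` with oracle `A` accepts `x`: some computation path is accepting. -/
def Accepts (M : OracleNPDA S D G) (A : Language D) (x : List S) : Prop :=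
  ∃ (n : ℕ) (c : M.Config), StepsIn (M.Step A) (M.init x) n c ∧ c.state ∈ M.acc

end OracleNPDA

/-! ### The CFL hierarchy of language families -/

/-- A language over some alphabet. -/
structure Lang where
  Alph : Type
  fin : Finite Alph
  lang : Language Alph

/-- Context-free languages. -/
def CFL : Set Lang := {L | L.lang.IsContextFree}

/-- Complements of the members of `C`. -/
def co (C : Set Lang) : Set Lang := {L | (⟨L.Alph, L.fin, L.langᶜ⟩ : Lang) ∈ C}

/-- Turing relativization of `CFL`: languages recognized by oracle npda's (whose output tape
plays no role: it has the empty alphabet) with an oracle from `C`. -/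
def CFLT (C : Set Lang) : Set Lang :=
  {L | ∃ A ∈ C, ∃ M : OracleNPDA L.Alph A.Alph Empty, M.Terminates ∧
    ∀ x, x ∈ L.lang ↔ M.Accepts A.lang x}

/-- The classes `Σ_k^CFL`, `k ≥ 1` (the value at `0` is not used), where `Π_k^CFL = co Σ_k^CFL`. -/
def SigmaCFL : ℕ → Set Lang
  | 0 => ∅
  | 1 => CFL
  | k + 2 => CFLT (co (SigmaCFL (k + 1)))

def PiCFL (k : ℕ) : Set Lang := co (SigmaCFL k)

/-! ### Function classes -/

/-- A multi-valued partial function from strings over the alphabet `In` to strings over the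
(alphabetically ordered) alphabet `Out`. -/
structure MVFun where
  In : Type
  Out : Type
  finIn : Finite In
  finOut : Finite Out
  ord : LinearOrder Out
  val : List In → Set (List Out)

def MVFun.SingleValued (f : MVFun) : Prop := ∀ x, (f.val x).Subsingleton

def MVFun.Total (f : MVFun) : Prop := ∀ x, (f.val x).Nonempty

def CFLMV : Set MVFun :=
  {f | ∃ M : NPDA f.In f.Out, M.Terminates ∧ ∀ x, f.val x = M.outputs x}

def CFLSV : Set MVFun := {f | f ∈ CFLMV ∧ f.SingleValued}

/-- Single-valued total functions in `CFLMV`. -/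
def CFLSVt : Set MVFun := {f | f ∈ CFLSV ∧ f.Total}

/-- Turing relativization of `CFLMV` to oracles from `C`. -/
def CFLMVT (C : Set Lang) : Set MVFun :=
  {f | ∃ A ∈ C, ∃ M : OracleNPDA f.In A.Alph f.Out, M.Terminates ∧
    ∀ x, f.val x = M.outputs A.lang x}

def CFLSVT (C : Set Lang) : Set MVFun := {f | f ∈ CFLMVT C ∧ f.SingleValued}

/-- The classes `Σ_k^CFL SV`, `k ≥ 1` (the value at `0` is not used). -/
def SigmaCFLSV : ℕ → Set MVFun
  | 0 => ∅
  | 1 => CFLSV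
  | k + 2 => CFLSVT (PiCFL (k + 1))

/-- The total functions in `Σ_k^CFL SV`. -/
def SigmaCFLSVt (k : ℕ) : Set MVFun := {f | f ∈ SigmaCFLSV k ∧ f.Total}

/-- `y` is the maximum of `Y` in the dictionary order (a proper prefix of a string precedes it). -/
def IsDictMax {G : Type} (ord : LinearOrder G) (Y : Set (List G)) (y : List G) : Prop :=
  y ∈ Y ∧ ∀ z ∈ Y, z = y ∨ List.Lex ord.lt z y

/-- `y` is the minimum of `Y` in the dictionary order. -/
def IsDictMin {G : Type} (ord : LinearOrder G) (Y : Set (List G)) (y : List G) : Prop :=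
  y ∈ Y ∧ ∀ z ∈ Y, z = y ∨ List.Lex ord.lt y z

/-- `OptCFL`: single-valued total functions whose value at every `x` is the maximum (or, at every
`x`, the minimum) of the valid outputs of a fixed npda on `x`; in particular the npda has an
accepting computation path on every input. -/
def OptCFL : Set MVFun :=
  {f | ∃ M : NPDA f.In f.Out, M.Terminates ∧
    ((∀ x, ∃ y, f.val x = {y} ∧ IsDictMax f.ord (M.outputs x) y) ∨
     (∀ x, ∃ y, f.val x = {y} ∧ IsDictMin f.ord (M.outputs x) y))}

/-! ### The separating function -/

/-- The alphabet consisting of the bits `0`, `1` and the separators `♮`, `#`. -/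
inductive PalSym : Type
  | bit (b : Bool) : PalSym
  | nat : PalSym
  | hash : PalSym

theorem PalSym.finite : Finite PalSym := by
  refine Finite.of_injective
    (fun s : PalSym => match s with
      | .bit b => some (some b)
      | .nat => some none
      | .hash => (none : Option (Option Bool))) ?_
  intro s t h
  cases s <;> cases t <;> simp_all

def bits (x : List Bool) : List PalSym := x.map PalSym.bit

/-- `{λ} ∪ {x_i y_i | w = x_1 ♮ x_2 ♮ x_3 # y_1 ♮ y_2 ♮ y_3, x_i = y_i^R, i ∈ {1,2,3}}`. -/
def palPairs (w : List PalSym) : Set (List Bool) :=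
  {[]} ∪ {s | ∃ x y : Fin 3 → List Bool,
    w = bits (x 0) ++ [PalSym.nat] ++ bits (x 1) ++ [PalSym.nat] ++ bits (x 2) ++ [PalSym.hash] ++
        bits (y 0) ++ [PalSym.nat] ++ bits (y 1) ++ [PalSym.nat] ++ bits (y 2) ∧
    ∃ i, x i = (y i).reverse ∧ s = x i ++ y i}

/-- `w ↦ max (palPairs w)`, with `0 < 1`. -/
def maxPalPair : MVFun where
  In := PalSym
  Out := Bool
  finIn := PalSym.finite
  finOut := inferInstance
  ord := inferInstance
  val w := {s | IsDictMax inferInstance (palPairs w) s}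

end CFLFun

/-! A single-valued npda for `maxPalPair` must output `λ` on `0^a ♮ 0^b ♮ # 0^c ♮ 0^d ♮` exactly
when neither `a = c ≠ 0` nor `b = d ≠ 0`. Cut an accepting run without output on
`0^i ♮ 0^i ♮ # 0^l ♮ 0^l ♮`, for `0 < i < l`, at the moment when its stack is lowest between the
end of the first block `0^i` and the end of the first block `0^l`. The cuts have finitely many
types, so by pigeonhole there are `i < j < l` such that the runs for `(i, j)` and `(j, l)` have
cuts of the same type. Exchanging parts of these runs yields an accepting run without output on a
word with a pair of equal nonempty blocks.

For the upper bound, an oracle npda guesses the optimal output `y` and asks whether some output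
`z` beats it. A machine that guesses `z` while it reads `y` cannot compare the two strings, so it
guesses the place of their first difference and asks whether the prefixes before it differ: the
strings in which two interleaved tracks differ form a context-free language. -/

namespace CFLFun

/-! ### Paths and stacks -/

theorem StepsIn.trans {α : Type} {r : α → α → Prop} {a b c : α} {m n : ℕ}
    (h₁ : StepsIn r a m b) (h₂ : StepsIn r b n c) : StepsIn r a (m + n) c := by
  induction h₂ with
  | refl => exact h₁
  | tail _ h ih => exact ih.tail h

theorem StepsIn.head {α : Type} {r : α → α → Prop} {a b c : α} {n : ℕ}
    (h₁ : r a b) (h₂ : StepsIn r b n c) : StepsIn r a (n + 1) c := by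
  rw [Nat.add_comm]
  exact (StepsIn.refl.tail h₁).trans h₂

theorem StepsIn.invariant {α : Type} {r : α → α → Prop} {a c : α} {n : ℕ} {P : ℕ → α → Prop}
    (h : StepsIn r a n c) (init : P 0 a) (step : ∀ {n b c}, P n b → r b c → P (n + 1) c) :
    P n c := by
  induction h with
  | refl => exact init
  | tail _ hr ih => exact step ih hr

instance Tape.finite {S : Type} [Finite S] : Finite (Tape S) :=
  Set.finite_univ_iff.mp <|
    ((Set.finite_range Tape.sym).union (Set.toFinite {.left, .right})).subset
      fun t _ ↦ by cases t <;> simp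

/-- The stack `γ` above an extra bottom symbol `none`, which the machines constructed below never
pop. -/
def withBottom {Z : Type} (γ : List Z) : List (Option Z) := γ.map some ++ [none]

theorem map_some_append_withBottom {Z : Type} (w γ : List Z) :
    w.map some ++ withBottom γ = withBottom (w ++ γ) := by
  simp [withBottom]

/-- What has to be pushed back when a machine with stack `withBottom γ` pops `z`. -/
def bottomOf {Z : Type} : Option Z → List (Option Z)
  | none => [none]
  | some _ => []

theorem withBottom_eq_cons {Z : Type} (γ : List Z) :
    ∃ v, withBottom γ = γ.head? :: v ∧ bottomOf γ.head? ++ v = withBottom γ.tail := by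
  cases γ <;> exact ⟨_, rfl, rfl⟩

namespace NPDA

variable {S G : Type}

theorem exists_push_bound [Finite S] (M : NPDA S G) :
    ∃ L, ∀ q a Z, ∀ r ∈ M.trans q a Z, r.2.1.length ≤ L := by
  have := M.finQ
  have := M.finStk
  have hfin : (⋃ t : M.Q × Option (Tape S) × M.Stk,
      (fun r ↦ r.2.1.length) '' M.trans t.1 t.2.1 t.2.2).Finite :=
    Set.finite_iUnion fun _ ↦ (M.finTrans _ _ _).image _
  obtain ⟨L, hL⟩ := hfin.bddAbove
  exact ⟨L, fun q a Z r hr ↦ hL (Set.mem_iUnion.2 ⟨(q, a, Z), r, hr, rfl⟩)⟩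

theorem Step.of_trans {M : NPDA S G} {q p : M.Q} {a : Option (Tape S)} {u : List (Tape S)}
    {Z : M.Stk} {v w : List M.Stk} {o : Option G} {y : List G} (hq : q ∉ M.halt)
    (ht : (p, w, o) ∈ M.trans q a Z) :
    M.Step ⟨q, a.toList ++ u, Z :: v, y⟩ ⟨p, u, w ++ v, y ++ o.toList⟩ := by
  cases a with
  | none => exact .stay hq ht
  | some a => exact .read hq ht

theorem Step.exists_trans {M : NPDA S G} {q : M.Q} {u : List (Tape S)} {γ : List M.Stk}
    {y : List G} {c : M.Config} (h : M.Step ⟨q, u, γ, y⟩ c) :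
    q ∉ M.halt ∧ ∃ a u' Z v p w o, u = a.toList ++ u' ∧ γ = Z :: v ∧
      (p, w, o) ∈ M.trans q a Z ∧ c = ⟨p, u', w ++ v, y ++ o.toList⟩ := by
  cases h with
  | stay hq ht => exact ⟨hq, none, _, _, _, _, _, _, rfl, rfl, ht, rfl⟩
  | read hq ht => exact ⟨hq, some _, _, _, _, _, _, _, rfl, rfl, ht, rfl⟩

/-! ### Runs without output -/

/-- `M.Silent q γ u p δ`: started in state `q` with stack `γ`, the machine can read exactly `u`,
write nothing, and arrive in state `p` with stack `δ`. -/
inductive Silent (M : NPDA S G) :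
    M.Q → List M.Stk → List (Tape S) → M.Q → List M.Stk → Prop
  | refl (q : M.Q) (γ : List M.Stk) : Silent M q γ [] q γ
  | step {q p r : M.Q} {Z : M.Stk} {v w γ : List M.Stk} {a : Option (Tape S)}
      {u : List (Tape S)} : q ∉ M.halt → (p, w, none) ∈ M.trans q a Z →
      Silent M p (w ++ v) u r γ → Silent M q (Z :: v) (a.toList ++ u) r γ

namespace Silent

variable {M : NPDA S G} {q p r : M.Q} {α β γ δ : List M.Stk} {u u₁ u₂ v : List (Tape S)}

theorem single {Z : M.Stk} {w v : List M.Stk} {a : Option (Tape S)} (hq : q ∉ M.halt)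
    (ht : (p, w, none) ∈ M.trans q a Z) : M.Silent q (Z :: v) a.toList p (w ++ v) := by
  simpa only [List.append_nil] using Silent.step hq ht (.refl p (w ++ v))

theorem trans (h₁ : M.Silent q γ u p δ) (h₂ : M.Silent p δ v r β) :
    M.Silent q γ (u ++ v) r β := by
  induction h₁ with
  | refl => exact h₂
  | step hq ht _ ih =>
    rw [List.append_assoc]
    exact .step hq ht (ih h₂)

theorem append_right (h : M.Silent q γ u p δ) (β : List M.Stk) :
    M.Silent q (γ ++ β) u p (δ ++ β) := by
  induction h with
  | refl => exact .refl _ _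
  | step hq ht _ ih =>
    rw [List.append_assoc] at ih
    exact .step hq ht ih

theorem exists_of_append (h : M.Silent q γ (u₁ ++ u₂) p δ) :
    ∃ r β, M.Silent q γ u₁ r β ∧ M.Silent r β u₂ p δ := by
  generalize hu : u₁ ++ u₂ = u at h
  induction h generalizing u₁ with
  | refl q γ =>
    obtain ⟨rfl, rfl⟩ := List.append_eq_nil_iff.1 hu
    exact ⟨q, γ, .refl _ _, .refl _ _⟩
  | @step q p r Z v w γ a u hq ht hs ih =>
    cases a with
    | none =>
      obtain ⟨s, β, h₁, h₂⟩ := ih hu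
      exact ⟨s, β, .step hq ht h₁, h₂⟩
    | some a =>
      cases u₁ with
      | nil =>
        obtain rfl : u₂ = _ := hu
        exact ⟨q, Z :: v, .refl _ _, .step hq ht hs⟩
      | cons b u₁ =>
        obtain ⟨rfl, hu'⟩ := List.cons.inj hu
        obtain ⟨s, β, h₁, h₂⟩ := ih hu'
        exact ⟨s, β, .step hq ht h₁, h₂⟩

theorem pop_or_stay (h : M.Silent q (α ++ β) u p δ) :
    (∃ u₁ u₂ r, u = u₁ ++ u₂ ∧ M.Silent q α u₁ r [] ∧ M.Silent r β u₂ p δ) ∨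
      ∃ α', M.Silent q α u p α' ∧ δ = α' ++ β := by
  generalize hγ : α ++ β = γ at h
  induction h generalizing α with
  | refl => exact .inr ⟨α, .refl _ _, hγ.symm⟩
  | @step q p r Z v w γ a u hq ht hs ih =>
    cases α with
    | nil =>
      obtain rfl : β = _ := hγ
      exact .inl ⟨[], _, q, rfl, .refl _ _, .step hq ht hs⟩
    | cons X α =>
      obtain ⟨rfl, rfl⟩ := List.cons.inj hγ
      rcases ih (α := w ++ α) (List.append_assoc ..) with
        ⟨u₁, u₂, s, rfl, h₁, h₂⟩ | ⟨α', h₁, h₂⟩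
      · exact .inl ⟨a.toList ++ u₁, u₂, s, (List.append_assoc ..).symm, .step hq ht h₁, h₂⟩
      · exact .inr ⟨α', .step hq ht h₁, h₂⟩

/-- The split is at the moment when the stack is lowest; `Z` is its top symbol at that moment. -/
theorem exists_low_point (h : M.Silent q γ u p δ) (hδ : δ ≠ []) :
    ∃ u₁ u₂ r α Z β α', u = u₁ ++ u₂ ∧ γ = α ++ Z :: β ∧ δ = α' ++ β ∧
      M.Silent q α u₁ r [] ∧ M.Silent r [Z] u₂ p α' := by
  induction h with
  | refl q γ =>
    obtain ⟨Z, β, rfl⟩ := List.exists_cons_of_ne_nil hδ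
    exact ⟨[], [], q, [], Z, β, [Z], rfl, rfl, rfl, .refl _ _, .refl _ _⟩
  | @step q p r Z v w γ a u hq ht hs ih =>
    obtain ⟨u₁, u₂, s, α, Y, β, α', rfl, h, rfl, h₁, h₂⟩ := ih hδ
    rcases List.append_eq_append_iff.1 h with ⟨α₀, rfl, rfl⟩ | ⟨_ | ⟨Y', β₀⟩, rfl, hβ⟩
    · exact ⟨a.toList ++ u₁, u₂, s, Z :: α₀, Y, β, α', (List.append_assoc ..).symm, rfl, rfl,
        .step hq ht h₁, h₂⟩
    · obtain rfl : Y :: β = v := hβ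
      rw [List.append_nil] at ht
      refine ⟨a.toList ++ u₁, u₂, s, [Z], Y, β, α', (List.append_assoc ..).symm, rfl, rfl,
        .step hq ht ?_, h₂⟩
      rwa [List.append_nil]
    · obtain ⟨rfl, rfl⟩ := List.cons.inj hβ
      refine ⟨[], _, q, [], Z, v, α' ++ β₀, rfl, rfl, (List.append_assoc ..).symm, .refl _ _,
        .step hq ht ?_⟩
      rw [List.append_nil]
      exact (h₁.append_right (Y :: β₀)).trans (h₂.append_right β₀)

/-- In the second case the part `α` of the final stack was built from the string `w`, which a
single push had put on top of `δ`. -/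
theorem exists_last_push {L : ℕ} (hL : ∀ q a Z, ∀ r ∈ M.trans q a Z, r.2.1.length ≤ L)
    (h : M.Silent q γ u p (α ++ δ)) :
    (∃ w, γ = w ++ δ ∧ M.Silent q w u p α) ∨
      ∃ u₁ u₂ r w, u = u₁ ++ u₂ ∧ w.length ≤ L ∧ M.Silent q γ u₁ r (w ++ δ) ∧
        M.Silent r w u₂ p α := by
  generalize hβ : α ++ δ = β at h
  induction h with
  | refl => exact .inl ⟨α, hβ.symm, .refl _ _⟩
  | @step q p r Z v w γ a u hq ht hs ih =>
    rcases ih hβ with ⟨w₁, h, h₁⟩ | ⟨u₁, u₂, s, w₁, rfl, hw, h₁, h₂⟩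
    · rcases List.append_eq_append_iff.1 h with ⟨α₀, rfl, rfl⟩ | ⟨β₀, rfl, rfl⟩
      · exact .inl ⟨Z :: α₀, rfl, .step hq ht h₁⟩
      · have hw : (w₁ ++ β₀).length ≤ L := hL _ _ _ _ ht
        rw [List.length_append] at hw
        refine .inr ⟨a.toList, u, p, w₁, rfl, by omega, ?_, h₁⟩
        simpa only [List.append_assoc] using single (v := v) hq ht
    · exact .inr ⟨a.toList ++ u₁, u₂, s, w₁, (List.append_assoc ..).symm, hw, .step hq ht h₁, h₂⟩

theorem stack_ne_nil (h : M.Silent q γ u p δ) (hu : u ≠ []) : γ ≠ [] := by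
  cases h with
  | refl => exact absurd rfl hu
  | step => exact List.cons_ne_nil _ _

theorem exists_stepsIn (h : M.Silent q γ u p δ) (v : List (Tape S)) :
    ∃ n, StepsIn M.Step ⟨q, u ++ v, γ, []⟩ n ⟨p, v, δ, []⟩ := by
  induction h with
  | refl => exact ⟨0, .refl⟩
  | step hq ht _ ih =>
    obtain ⟨n, hn⟩ := ih
    refine ⟨n + 1, StepsIn.head ?_ hn⟩
    rw [List.append_assoc]
    exact Step.of_trans (y := []) hq ht

end Silent

theorem silent_of_stepsIn {M : NPDA S G} {x : List S} {n : ℕ} {c : M.Config}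
    (h : StepsIn M.Step (M.init x) n c) (hc : c.output = []) :
    ∃ u, tapeOf x = u ++ c.input ∧ M.Silent M.start [M.bottom] u c.state c.stack := by
  induction h with
  | refl => exact ⟨[], rfl, .refl _ _⟩
  | tail _ hs ih =>
    obtain ⟨hq, a, u', Z, v, p, w, o, hu', hγ, ht, rfl⟩ := hs.exists_trans
    obtain ⟨hy, ho⟩ := List.append_eq_nil_iff.1 hc
    rw [Option.toList_eq_nil_iff] at ho
    subst ho
    obtain ⟨u, hu, h⟩ := ih hy
    rw [hγ] at h
    exact ⟨u ++ a.toList, by rw [hu, hu', List.append_assoc], h.trans (.single hq ht)⟩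

theorem nil_mem_outputs_iff {M : NPDA S G} {x : List S} :
    [] ∈ M.outputs x ↔ ∃ u v q γ, tapeOf x = u ++ v ∧
      M.Silent M.start [M.bottom] u q γ ∧ q ∈ M.acc := by
  constructor
  · rintro ⟨n, c, h, hc, ho⟩
    obtain ⟨u, hu, h'⟩ := silent_of_stepsIn h ho
    exact ⟨u, _, _, _, hu, h', hc⟩
  · rintro ⟨u, v, q, γ, hu, h, hq⟩
    obtain ⟨n, hn⟩ := h.exists_stepsIn v
    refine ⟨n, ⟨q, v, γ, []⟩, ?_, hq, rfl⟩
    rwa [NPDA.init, hu]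

end NPDA

/-! ### The separating function is not computed by a single-valued npda -/

theorem exists_monochromatic_chain {K : Type} [Finite K] (P : K → ℕ → ℕ → Prop)
    (h : ∀ i j, i < j → ∃ c, P c i j) : ∃ c i j l, i < j ∧ j < l ∧ P c i j ∧ P c j l := by
  obtain ⟨i, j, hij, he⟩ :=
    Finite.exists_ne_map_eq_of_infinite (fun i ↦ {c : K | ∃ l, i < l ∧ P c i l})
  wlog hlt : i < j generalizing i j
  · exact this j i hij.symm he.symm (by omega)
  obtain ⟨c, hc⟩ := h i j hlt
  obtain ⟨l, hjl, hcl⟩ : c ∈ {c : K | ∃ l, j < l ∧ P c j l} := he ▸ ⟨j, hlt, hc⟩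
  exact ⟨c, i, j, l, hlt, hjl, hc, hcl⟩

theorem isRegular_singleton {α : Type} (w : List α) : ({w} : Language α).IsRegular := by
  have hfin : (singleton '' {v | v <:+ w} : Set (Language α)).Finite :=
    ((w.tails.finite_toSet.subset fun v hv ↦ (List.mem_tails v w).2 hv).image _)
  refine .of_finite_range_leftQuotient ((hfin.insert ⊥).subset ?_)
  rintro _ ⟨u, rfl⟩
  by_cases h : u <+: w
  · obtain ⟨v, rfl⟩ := h
    refine .inr ⟨v, List.suffix_append u v, ?_⟩
    ext v'
    exact (List.append_right_inj u).symm
  · refine .inl (Set.eq_empty_of_forall_notMem fun v hv ↦ h ⟨v, hv⟩)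

theorem isRegular_range_replicate {α : Type} (a : α) :
    Language.IsRegular (Set.range (List.replicate · a) : Set (List α)) := by
  refine .of_finite_range_leftQuotient (Set.Finite.subset (Set.toFinite
    {(Set.range (List.replicate · a) : Language α), ⊥}) ?_)
  rintro _ ⟨u, rfl⟩
  by_cases hu : u = List.replicate u.length a
  · left
    ext v
    constructor
    · rintro ⟨n, h⟩
      exact ⟨_, (List.append_eq_replicate_iff.1 h.symm).2.2.symm⟩
    · rintro ⟨n, rfl⟩
      rw [hu]
      exact ⟨_, List.replicate_add ..⟩
  · right
    refine Set.eq_empty_of_forall_notMem fun v ⟨n, h⟩ ↦ hu ?_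
    exact (List.append_eq_replicate_iff.1 h.symm).2.1

theorem isRegular_mul {α : Type} {L M : Language α} (hL : L.IsRegular) (hM : M.IsRegular) :
    (L * M).IsRegular := by
  refine .of_finite_range_leftQuotient (Set.Finite.subset (Set.Finite.image2
    (fun L' Q ↦ L' * M + sSup Q) hL.finite_range_leftQuotient
      hM.finite_range_leftQuotient.finite_subsets) ?_)
  rintro _ ⟨u, rfl⟩
  refine ⟨L.leftQuotient u, ⟨u, rfl⟩,
    {Q | ∃ u₁ ∈ L, ∃ u₂, u₁ ++ u₂ = u ∧ M.leftQuotient u₂ = Q}, ?_, ?_⟩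
  · rintro _ ⟨-, -, u₂, -, rfl⟩
    exact ⟨u₂, rfl⟩
  ext v
  constructor
  · rintro (⟨v₁, h₁, v₂, h₂, rfl⟩ | ⟨_, ⟨u₁, h₁, u₂, rfl, rfl⟩, h₂⟩)
    · exact ⟨u ++ v₁, h₁, v₂, h₂, List.append_assoc ..⟩
    · exact ⟨u₁, h₁, u₂ ++ v, h₂, (List.append_assoc ..).symm⟩
  · rintro ⟨w₁, h₁, w₂, h₂, h : w₁ ++ w₂ = u ++ v⟩
    rcases List.append_eq_append_iff.1 h with ⟨u₂, rfl, rfl⟩ | ⟨v₁, rfl, rfl⟩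
    · exact .inr ⟨_, ⟨w₁, h₁, u₂, rfl, rfl⟩, h₂⟩
    · exact .inl ⟨v₁, h₁, w₂, h₂, rfl⟩

theorem isRegular_range_append_replicate_append {α : Type} (p s : List α) (a : α) :
    Language.IsRegular (Set.range fun n ↦ p ++ List.replicate n a ++ s) := by
  have h := isRegular_mul (isRegular_mul (isRegular_singleton p) (isRegular_range_replicate a))
    (isRegular_singleton s)
  change Language.IsRegular (Set.image2 _ (Set.image2 _ {p} _) {s}) at h
  rwa [Set.image2_singleton_right, Set.image2_singleton_left, ← Set.range_comp,
    ← Set.range_comp] at h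

/-- The word `x₁♮x₂♮x₃#y₁♮y₂♮y₃`, with indices starting at `0`. -/
def palWord (x y : Fin 3 → List Bool) : List PalSym :=
  bits (x 0) ++ [PalSym.nat] ++ bits (x 1) ++ [PalSym.nat] ++ bits (x 2) ++ [PalSym.hash] ++
    bits (y 0) ++ [PalSym.nat] ++ bits (y 1) ++ [PalSym.nat] ++ bits (y 2)

theorem bits_append_cons_inj {x x' : List Bool} {c c' : PalSym} {r r' : List PalSym}
    (hc : ∀ b, c ≠ .bit b) (hc' : ∀ b, c' ≠ .bit b)
    (h : bits x ++ c :: r = bits x' ++ c' :: r') : x = x' ∧ r = r' := by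
  induction x generalizing x' with
  | nil =>
    cases x' with
    | nil => exact ⟨rfl, (List.cons.inj h).2⟩
    | cons b x' => exact absurd (List.cons.inj h).1 (hc b)
  | cons b x ih =>
    cases x' with
    | nil => exact absurd (List.cons.inj h).1.symm (hc' b)
    | cons b' x' =>
      obtain ⟨hb, h⟩ := List.cons.inj h
      obtain ⟨rfl, rfl⟩ := ih h
      exact ⟨congrArg (· :: x) (PalSym.bit.inj hb), rfl⟩

theorem palWord_injective2 : Function.Injective2 palWord := by
  intro x x' y y' h
  simp only [palWord, List.append_assoc, List.singleton_append] at h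
  obtain ⟨h₁, h⟩ := bits_append_cons_inj (by simp) (by simp) h
  obtain ⟨h₂, h⟩ := bits_append_cons_inj (by simp) (by simp) h
  obtain ⟨h₃, h⟩ := bits_append_cons_inj (by simp) (by simp) h
  obtain ⟨h₄, h⟩ := bits_append_cons_inj (by simp) (by simp) h
  obtain ⟨h₅, h⟩ := bits_append_cons_inj (by simp) (by simp) h
  have h₆ : y 2 = y' 2 := List.map_injective_iff.2 (fun _ _ ↦ PalSym.bit.inj) h
  exact ⟨funext (Fin.forall_fin_succ.2 ⟨h₁, by simp [Fin.forall_fin_succ, h₂, h₃]⟩),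
    funext (Fin.forall_fin_succ.2 ⟨h₄, by simp [Fin.forall_fin_succ, h₅, h₆]⟩)⟩

theorem mem_palPairs_palWord_iff {x y : Fin 3 → List Bool} {s : List Bool} :
    s ∈ palPairs (palWord x y) ↔ s = [] ∨ ∃ i, x i = (y i).reverse ∧ s = x i ++ y i := by
  refine or_congr Iff.rfl ⟨?_, fun h ↦ ⟨x, y, rfl, h⟩⟩
  rintro ⟨x', y', h, i, hi⟩
  obtain ⟨rfl, rfl⟩ := palWord_injective2 h
  exact ⟨i, hi⟩

theorem palPairs_palWord_eq_singleton_iff {x y : Fin 3 → List Bool} :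
    palPairs (palWord x y) = {[]} ↔ ∀ i, x i = (y i).reverse → y i = [] := by
  rw [Set.eq_singleton_iff_unique_mem, and_iff_right (.inl rfl)]
  constructor
  · intro h i hi
    exact (List.append_eq_nil_iff.1 (h _ (mem_palPairs_palWord_iff.2 (.inr ⟨i, hi, rfl⟩)))).2
  · intro h s hs
    obtain rfl | ⟨i, hi, rfl⟩ := mem_palPairs_palWord_iff.1 hs
    · rfl
    · rw [hi, h i hi, List.reverse_nil, List.append_nil]

/-- The word `0^a ♮ 0^b ♮ # 0^c ♮ 0^d ♮`. -/
def zeroWord (a b c d : ℕ) : List PalSym :=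
  palWord ![.replicate a false, .replicate b false, []]
    ![.replicate c false, .replicate d false, []]

theorem palPairs_zeroWord_eq_singleton_iff {a b c d : ℕ} :
    palPairs (zeroWord a b c d) = {[]} ↔ (a = c → c = 0) ∧ (b = d → d = 0) := by
  simp [zeroWord, palPairs_palWord_eq_singleton_iff, Fin.forall_fin_succ]

/-- `n` zeros on the input tape. -/
def zeros (n : ℕ) : List (Tape PalSym) := List.replicate n (.sym (.bit false))

/-- The tape of a `zeroWord` up to the first separator. -/
def tapeA (a : ℕ) : List (Tape PalSym) := [.left] ++ zeros a ++ [.sym .nat]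

/-- The second block of the tape of a `zeroWord`, with the separator after it.  The empty prefix
gives it the shape that `finite_range_continuations` expects. -/
def tapeB (b : ℕ) : List (Tape PalSym) := [] ++ zeros b ++ [.sym .nat]

/-- The end of the tape of a `zeroWord`, from the separator before its last nonempty block. -/
def tapeD (d : ℕ) : List (Tape PalSym) := [.sym .nat] ++ zeros d ++ [.sym .nat, .right]

theorem tapeOf_zeroWord (a b c d : ℕ) : tapeOf (zeroWord a b c d) =
    tapeA a ++ (tapeB b ++ .sym .hash :: (zeros c ++ tapeD d)) := by
  simp [tapeOf, zeroWord, palWord, tapeA, tapeB, tapeD, zeros, bits]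

/-- The set of continuations of `u` to a member of the family `t` of tape segments. -/
def continuations (t : ℕ → List (Tape PalSym)) (u : List (Tape PalSym)) :
    Language (Tape PalSym) :=
  Language.leftQuotient (Set.range t) u

theorem exists_append_eq_of_continuations_eq {t : ℕ → List (Tape PalSym)}
    {u₁ v₁ v₂ : List (Tape PalSym)} {n : ℕ} (h : continuations t u₁ = continuations t v₁)
    (hv : t n = v₁ ++ v₂) : ∃ k, t k = u₁ ++ v₂ := by
  have : v₂ ∈ continuations t v₁ := ⟨n, hv⟩
  rwa [← h] at this

theorem finite_range_continuations (p s : List (Tape PalSym)) :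
    Finite (Set.range (continuations fun n ↦ p ++ zeros n ++ s)) :=
  (isRegular_range_append_replicate_append p s _).finite_range_leftQuotient

namespace NPDA

variable {G : Type}

/-- An accepting silent run that reads `u₁ ++ u₂ ++ u₃` and, while reading `u₂`, goes from state
`s` to state `p` and pops `w`, without touching the stack below `w`. -/
def Excursion (M : NPDA PalSym G) (s : M.Q) (w : List M.Stk) (p : M.Q)
    (u₁ u₂ u₃ : List (Tape PalSym)) : Prop :=
  ∃ δ f γ, M.Silent M.start [M.bottom] u₁ s (w ++ δ) ∧ M.Silent s w u₂ p [] ∧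
    M.Silent p δ u₃ f γ ∧ f ∈ M.acc

variable {M : NPDA PalSym G} {s p r : M.Q} {w : List M.Stk} {Z : M.Stk} {i l i' l' L : ℕ}
  {Q R : Language (Tape PalSym)} {x : List PalSym} {u₁ u₂ u₃ v u₁' u₂' u₃' : List (Tape PalSym)}

theorem nil_mem_outputs_of_silent {f : M.Q} {γ : List M.Stk}
    (h : M.Silent M.start [M.bottom] u₁ f γ) (hf : f ∈ M.acc) (hx : tapeOf x = u₁ ++ v) :
    [] ∈ M.outputs x :=
  nil_mem_outputs_iff.2 ⟨u₁, v, f, γ, hx, h, hf⟩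

theorem Excursion.swap (h : M.Excursion s w p u₁ u₂ u₃) (h' : M.Excursion s w p u₁' u₂' u₃') :
    M.Excursion s w p u₁ u₂' u₃ :=
  let ⟨δ, f, γ, h₁, _, h₃, hf⟩ := h
  let ⟨_, _, _, _, h₂, _, _⟩ := h'
  ⟨δ, f, γ, h₁, h₂, h₃, hf⟩

theorem Excursion.nil_mem_outputs (h : M.Excursion s w p u₁ u₂ u₃)
    (hx : tapeOf x = u₁ ++ u₂ ++ u₃ ++ v) : [] ∈ M.outputs x :=
  let ⟨δ, _, _, h₁, h₂, h₃, hf⟩ := h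
  nil_mem_outputs_of_silent ((h₁.trans (h₂.append_right δ)).trans h₃) hf hx

variable (M) in
/-- An accepting silent run on `zeroWord i i l l` with an excursion that starts in the first block
of the left half and ends in the first block of the right half. -/
def CutAcross (s : M.Q) (w : List M.Stk) (p : M.Q) (Q : Language (Tape PalSym)) (i l : ℕ) :
    Prop :=
  ∃ A₁ A₂ C₁ C₂ D₁ D₂, tapeA i = A₁ ++ A₂ ∧ zeros l = C₁ ++ C₂ ∧ tapeD l = D₁ ++ D₂ ∧
    continuations tapeA A₁ = Q ∧
    M.Excursion s w p A₁ (A₂ ++ (tapeB i ++ .sym .hash :: C₁)) (C₂ ++ D₁)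

variable (M) in
/-- An accepting silent run on `zeroWord i i l l` with an excursion that starts in the second block
of the left half and ends after the first block of the right half. -/
def CutRight (p : M.Q) (Z : M.Stk) (r : M.Q) (Q R : Language (Tape PalSym)) (i l : ℕ) : Prop :=
  ∃ B₁ B₂ D₁ D₂ D₃, tapeB i = B₁ ++ B₂ ∧ tapeD l = D₁ ++ (D₂ ++ D₃) ∧
    continuations tapeB B₁ = Q ∧ continuations tapeD D₁ = R ∧
    M.Excursion p [Z] r (tapeA i ++ B₁) (B₂ ++ .sym .hash :: (zeros l ++ D₁)) D₂

variable (M) in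
/-- An accepting silent run on `zeroWord i i l l` that never goes below `Z` on the stack from some
moment in the second block of the left half on. -/
def CutEnd (p : M.Q) (Z : M.Stk) (Q : Language (Tape PalSym)) (i l : ℕ) : Prop :=
  ∃ B₁ B₂ D₁ D₂ β f γ, tapeB i = B₁ ++ B₂ ∧ tapeD l = D₁ ++ D₂ ∧ continuations tapeB B₁ = Q ∧
    M.Silent M.start [M.bottom] (tapeA i ++ B₁) p (Z :: β) ∧
    M.Silent p [Z] (B₂ ++ .sym .hash :: (zeros l ++ D₁)) f γ ∧ f ∈ M.acc

theorem CutAcross.swap (h : M.CutAcross s w p Q i l) (h' : M.CutAcross s w p Q i' l') :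
    ∃ a c, [] ∈ M.outputs (zeroWord a i' c l) := by
  obtain ⟨A₁, A₂, C₁, C₂, D₁, D₂, -, hC, hD, hQ, h⟩ := h
  obtain ⟨A₁', A₂', C₁', C₂', D₁', D₂', hA', hC', -, hQ', h'⟩ := h'
  obtain ⟨a, ha⟩ := exists_append_eq_of_continuations_eq (hQ.trans hQ'.symm) hA'
  have hc : zeros (C₁'.length + C₂.length) = C₁' ++ C₂ := by
    rw [zeros, List.replicate_add]
    exact congrArg₂ _ (List.append_eq_replicate_iff.1 hC'.symm).2.1.symm
      (List.append_eq_replicate_iff.1 hC.symm).2.2.symm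
  refine ⟨a, C₁'.length + C₂.length, (h.swap h').nil_mem_outputs (v := D₂) ?_⟩
  rw [tapeOf_zeroWord, ha, hc, hD]
  simp only [List.append_assoc, List.cons_append]

theorem CutRight.swap (h : M.CutRight p Z r Q R i l) (h' : M.CutRight p Z r Q R i' l') :
    ∃ b d, [] ∈ M.outputs (zeroWord i b l' d) := by
  obtain ⟨B₁, B₂, D₁, D₂, D₃, -, hD, hQ, hR, h⟩ := h
  obtain ⟨B₁', B₂', D₁', D₂', D₃', hB', -, hQ', hR', h'⟩ := h'
  obtain ⟨b, hb⟩ := exists_append_eq_of_continuations_eq (hQ.trans hQ'.symm) hB'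
  obtain ⟨d, hd⟩ := exists_append_eq_of_continuations_eq (hR'.trans hR.symm) hD
  refine ⟨b, d, (h.swap h').nil_mem_outputs (v := D₃) ?_⟩
  rw [tapeOf_zeroWord, hb, hd]
  simp only [List.append_assoc, List.cons_append]

theorem CutEnd.swap (h : M.CutEnd p Z Q i l) (h' : M.CutEnd p Z Q i' l') :
    ∃ b d, [] ∈ M.outputs (zeroWord i b l' d) := by
  obtain ⟨B₁, B₂, D₁, D₂, β, f, γ, -, -, hQ, h, -, -⟩ := h
  obtain ⟨B₁', B₂', D₁', D₂', β', f', γ', hB', hD', hQ', -, h', hf'⟩ := h'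
  obtain ⟨b, hb⟩ := exists_append_eq_of_continuations_eq (hQ.trans hQ'.symm) hB'
  refine ⟨b, l', nil_mem_outputs_of_silent (v := D₂') (h.trans (h'.append_right β)) hf' ?_⟩
  rw [tapeOf_zeroWord, hb, hD']
  simp only [List.append_assoc, List.cons_append]

/-- A run that accepts without reading beyond the block `0^l` would also accept if the last block
were different. -/
theorem exists_silent_of_nil_mem_outputs (h : [] ∈ M.outputs (zeroWord i i l l))
    (h' : [] ∉ M.outputs (zeroWord i i l i)) :
    ∃ D₁ D₂ q₁ γ₁ q₂ γ₂ f γ, tapeD l = D₁ ++ D₂ ∧ γ₂ ≠ [] ∧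
      M.Silent M.start [M.bottom] (tapeA i) q₁ γ₁ ∧
      M.Silent q₁ γ₁ (tapeB i ++ .sym .hash :: zeros l) q₂ γ₂ ∧
      M.Silent q₂ γ₂ D₁ f γ ∧ f ∈ M.acc := by
  obtain ⟨u, v, f, γ, hu, hs, hf⟩ := nil_mem_outputs_iff.1 h
  have htape : ∀ d, tapeOf (zeroWord i i l d) =
      (tapeA i ++ (tapeB i ++ .sym .hash :: zeros l)) ++ tapeD d := fun d ↦ by
    simp only [tapeOf_zeroWord, List.append_assoc, List.cons_append]
  rw [htape] at hu
  rcases List.append_eq_append_iff.1 hu with ⟨D₁, rfl, hD⟩ | ⟨v', hv', rfl⟩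
  · obtain ⟨q₂, γ₂, hs, h₃⟩ := hs.exists_of_append
    obtain ⟨q₁, γ₁, h₁, h₂⟩ := hs.exists_of_append
    refine ⟨D₁, v, q₁, γ₁, q₂, γ₂, f, γ, hD, h₃.stack_ne_nil ?_, h₁, h₂, h₃, hf⟩
    rintro rfl
    exact h' (nil_mem_outputs_of_silent (v := tapeD i) hs hf (by rw [htape, List.append_nil]))
  · refine absurd (nil_mem_outputs_of_silent (v := v' ++ tapeD i) hs hf ?_) h'
    rw [htape, hv', List.append_assoc]

theorem exists_cutAcross {C₁ C₂ D₁ D₂ : List (Tape PalSym)} {q f : M.Q} {α β γ : List M.Stk}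
    (hL : ∀ q a Z, ∀ r ∈ M.trans q a Z, r.2.1.length ≤ L)
    (hC : zeros l = C₁ ++ C₂) (hD : tapeD l = D₁ ++ D₂)
    (h₁ : M.Silent M.start [M.bottom] (tapeA i) q (α ++ β))
    (h₂ : M.Silent q α (tapeB i ++ .sym .hash :: C₁) p [])
    (h₃ : M.Silent p β (C₂ ++ D₁) f γ) (hf : f ∈ M.acc) :
    ∃ s w Q, w.length ≤ L + 1 ∧ M.CutAcross s w p (continuations tapeA Q) i l := by
  obtain ⟨A₁, A₂, s, w, hA, hw, hs₁, hs₂⟩ : ∃ A₁ A₂ s w, tapeA i = A₁ ++ A₂ ∧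
      w.length ≤ L + 1 ∧ M.Silent M.start [M.bottom] A₁ s (w ++ β) ∧ M.Silent s w A₂ q α := by
    rcases h₁.exists_last_push hL with ⟨w, hw, h⟩ | ⟨A₁, A₂, s, w, hA, hw, h⟩
    · have hlen : 1 = (w ++ β).length := congrArg List.length hw
      rw [List.length_append] at hlen
      exact ⟨[], tapeA i, M.start, w, rfl, by omega, hw ▸ .refl _ _, h⟩
    · exact ⟨A₁, A₂, s, w, hA, by omega, h⟩
  exact ⟨s, w, A₁, hw, A₁, A₂, C₁, C₂, D₁, D₂, hA, hC, hD, rfl, β, f, γ, hs₁, hs₂.trans h₂,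
    h₃, hf⟩

theorem exists_cutRight_or_cutEnd {B₁ B₂ D₁ D₂ : List (Tape PalSym)} {q f : M.Q}
    {α β γ : List M.Stk} (hB : tapeB i = B₁ ++ B₂) (hD : tapeD l = D₁ ++ D₂)
    (h₁ : M.Silent M.start [M.bottom] (tapeA i ++ B₁) p (Z :: β))
    (h₂ : M.Silent p [Z] (B₂ ++ .sym .hash :: zeros l) q α)
    (h₃ : M.Silent q (α ++ β) D₁ f γ) (hf : f ∈ M.acc) :
    (∃ r Q R, M.CutRight p Z r (continuations tapeB Q) (continuations tapeD R) i l) ∨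
      ∃ Q, M.CutEnd p Z (continuations tapeB Q) i l := by
  rcases h₃.pop_or_stay with ⟨D', D'', r, rfl, hr, hr'⟩ | ⟨δ, hδ, -⟩
  · refine .inl ⟨r, B₁, D', B₁, B₂, D', D'', D₂, hB, ?_, rfl, rfl, β, f, γ, h₁, ?_, hr', hf⟩
    · rw [hD, List.append_assoc]
    · simpa only [List.append_assoc, List.cons_append] using h₂.trans hr
  · refine .inr ⟨B₁, B₁, B₂, D₁, D₂, β, f, δ, hB, hD, rfl, h₁, ?_, hf⟩
    simpa only [List.append_assoc, List.cons_append] using h₂.trans hδ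

/-- The run is cut where its stack is lowest between the end of the first block and the end of the
third nonempty one. -/
theorem exists_cut (hL : ∀ q a Z, ∀ r ∈ M.trans q a Z, r.2.1.length ≤ L)
    (h : [] ∈ M.outputs (zeroWord i i l l)) (h' : [] ∉ M.outputs (zeroWord i i l i)) :
    (∃ s w p Q, w.length ≤ L + 1 ∧ M.CutAcross s w p (continuations tapeA Q) i l) ∨
      (∃ p Z r Q R, M.CutRight p Z r (continuations tapeB Q) (continuations tapeD R) i l) ∨
      ∃ p Z Q, M.CutEnd p Z (continuations tapeB Q) i l := by
  obtain ⟨D₁, D₂, q₁, γ₁, q₂, γ₂, f, γ, hD, hne, h₁, h₂, h₃, hf⟩ :=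
    exists_silent_of_nil_mem_outputs h h'
  obtain ⟨u₁, u₂, p, α, Z, β, α', he, rfl, rfl, hp, hZ⟩ := h₂.exists_low_point hne
  have hsplit : (∃ C₁, u₁ = tapeB i ++ .sym .hash :: C₁ ∧ zeros l = C₁ ++ u₂) ∨
      ∃ B₂, tapeB i = u₁ ++ B₂ ∧ u₂ = B₂ ++ .sym .hash :: zeros l := by
    rcases List.append_eq_append_iff.1 he with ⟨_ | ⟨c, C₁⟩, rfl, hC⟩ | ⟨B₂, hB, rfl⟩
    · exact .inr ⟨[], by simp only [List.append_nil], hC.symm⟩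
    · obtain ⟨rfl, hC'⟩ := List.cons.inj hC
      exact .inl ⟨C₁, rfl, hC'⟩
    · exact .inr ⟨B₂, hB, rfl⟩
  rcases hsplit with ⟨C₁, rfl, hC⟩ | ⟨B₂, hB, rfl⟩
  · obtain ⟨s, w, Q, hw, hcut⟩ :=
      exists_cutAcross hL hC hD h₁ hp ((hZ.append_right β).trans h₃) hf
    exact .inl ⟨s, w, p, Q, hw, hcut⟩
  · obtain ⟨r, Q, R, hcut⟩ | ⟨Q, hcut⟩ := exists_cutRight_or_cutEnd hB hD
      (h₁.trans (hp.append_right (Z :: β))) hZ h₃ hf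
    · exact .inr (.inl ⟨p, Z, r, Q, R, hcut⟩)
    · exact .inr (.inr ⟨p, Z, Q, hcut⟩)

theorem exists_nil_mem_outputs_of_forall (M : NPDA PalSym G)
    (h : ∀ i l, i < l → [] ∈ M.outputs (zeroWord (i + 1) (i + 1) (l + 1) (l + 1)))
    (h' : ∀ i l, [] ∉ M.outputs (zeroWord (i + 1) (i + 1) (l + 1) (i + 1))) :
    ∃ j, (∃ a c, [] ∈ M.outputs (zeroWord a (j + 1) c (j + 1))) ∨
      ∃ b d, [] ∈ M.outputs (zeroWord (j + 1) b (j + 1) d) := by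
  have : Finite PalSym := PalSym.finite
  have := M.finQ
  have := M.finStk
  obtain ⟨L, hL⟩ := M.exists_push_bound
  have : Finite {w : List M.Stk // w.length ≤ L + 1} := List.finite_length_le _ _
  have : Finite (Set.range (continuations tapeA)) :=
    finite_range_continuations [.left] [.sym .nat]
  have : Finite (Set.range (continuations tapeB)) :=
    finite_range_continuations [] [.sym .nat]
  have : Finite (Set.range (continuations tapeD)) :=
    finite_range_continuations [.sym .nat] [.sym .nat, .right]
  let P : (M.Q × {w : List M.Stk // w.length ≤ L + 1} × M.Q × Set.range (continuations tapeA)) ⊕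
      (M.Q × M.Stk × M.Q × Set.range (continuations tapeB) × Set.range (continuations tapeD)) ⊕
      (M.Q × M.Stk × Set.range (continuations tapeB)) → ℕ → ℕ → Prop
    | .inl (s, w, p, Q), i, l => M.CutAcross s w p Q (i + 1) (l + 1)
    | .inr (.inl (p, Z, r, Q, R)), i, l => M.CutRight p Z r Q R (i + 1) (l + 1)
    | .inr (.inr (p, Z, Q)), i, l => M.CutEnd p Z Q (i + 1) (l + 1)
  obtain ⟨c, i, j, l, -, -, hij, hjl⟩ := exists_monochromatic_chain P fun i l hil ↦ by
    rcases exists_cut hL (h i l hil) (h' i l) with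
      ⟨s, w, p, Q, hw, hc⟩ | ⟨p, Z, r, Q, R, hc⟩ | ⟨p, Z, Q, hc⟩
    · exact ⟨.inl (s, ⟨w, hw⟩, p, ⟨_, Q, rfl⟩), hc⟩
    · exact ⟨.inr (.inl (p, Z, r, ⟨_, Q, rfl⟩, ⟨_, R, rfl⟩)), hc⟩
    · exact ⟨.inr (.inr (p, Z, ⟨_, Q, rfl⟩)), hc⟩
  rcases c with ⟨s, w, p, Q⟩ | ⟨p, Z, r, Q, R⟩ | ⟨p, Z, Q⟩
  · exact ⟨j, .inl (CutAcross.swap hij hjl)⟩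
  · exact ⟨j, .inr (CutRight.swap hjl hij)⟩
  · exact ⟨j, .inr (CutEnd.swap hjl hij)⟩

theorem not_forall_nil_mem_outputs_iff (M : NPDA PalSym G) :
    ¬ ∀ w, [] ∈ M.outputs w ↔ palPairs w = {[]} := by
  intro hM
  obtain ⟨j, ⟨a, c, h⟩ | ⟨b, d, h⟩⟩ := M.exists_nil_mem_outputs_of_forall
    (fun i l hil ↦ by rw [hM, palPairs_zeroWord_eq_singleton_iff]; omega)
    (fun i l ↦ by rw [hM, palPairs_zeroWord_eq_singleton_iff]; omega)
  · rw [hM, palPairs_zeroWord_eq_singleton_iff] at h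
    omega
  · rw [hM, palPairs_zeroWord_eq_singleton_iff] at h
    omega

end NPDA

theorem nil_mem_maxPalPair_iff {w : List PalSym} :
    [] ∈ maxPalPair.val w ↔ palPairs w = {[]} := by
  rw [Set.eq_singleton_iff_unique_mem]
  exact and_congr_right' (forall₂_congr fun z _ ↦ or_iff_left List.not_lex_nil)

theorem maxPalPair_notMem_CFLSVt : maxPalPair ∉ CFLSVt := by
  rintro ⟨⟨⟨M, -, hM⟩, -⟩, -⟩
  refine M.not_forall_nil_mem_outputs_iff fun w ↦ ?_
  rw [← nil_mem_maxPalPair_iff]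
  exact (Set.ext_iff.1 (hM w) []).symm

/-! ### Real-time machines -/

theorem toList_head?_append_tail {α : Type} (l : List α) : l.head?.toList ++ l.tail = l := by
  cases l <;> rfl

/-- A pushdown transducer that reads one input symbol in each step, sees `none` when its stack is
empty, and ends its computation after the last input symbol.  An element `(c, w, o)` of `move`
means: enter `c`, replace the topmost stack symbol (if any) by `w`, and write `o` (or nothing). -/
structure RealTime (S G : Type) where
  C : Type
  Z : Type
  finC : Finite C
  finZ : Finite Z
  start : Set C
  move : C → Option Z → S → Set (C × List Z × Option G)
  finite_move : ∀ c z a, (move c z a).Finite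
  finish : C → Option Z → Prop

namespace RealTime

variable {S G : Type}

/-- The valid outputs of the computations with control `c` and stack `γ` that read exactly the given
word. -/
def outputsFrom (M : RealTime S G) : M.C → List M.Z → List S → Set (List G)
  | c, γ, [] => {y | y = [] ∧ M.finish c γ.head?}
  | c, γ, a :: u => {y | ∃ r ∈ M.move c γ.head? a,
      ∃ y' ∈ M.outputsFrom r.1 (r.2.1 ++ γ.tail) u, y = r.2.2.toList ++ y'}

/-- The valid outputs of `M` on `x`. -/
def outputs (M : RealTime S G) (x : List S) : Set (List G) :=
  {y | ∃ c ∈ M.start, y ∈ M.outputsFrom c [] x}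

/-- The states of `RealTime.toNPDA`. -/
inductive State (C : Type) : Type
  | start : State C
  | run (c : C) : State C
  | accept : State C
  | reject : State C

instance State.finite {C : Type} [Finite C] : Finite (State C) :=
  Set.finite_univ_iff.mp <|
    ((Set.finite_range State.run).union (Set.toFinite {.start, .accept, .reject})).subset
      fun q _ ↦ by cases q <;> simp

/-- The transitions of `RealTime.toNPDA`, which may give up by a `λ`-move at any time. -/
def trans (M : RealTime S G) : State M.C → Option (Tape S) → Option M.Z →
    Set (State M.C × List (Option M.Z) × Option G)
  | _, none, z => {(.reject, [z], none)}
  | .start, some .left, z => (fun c ↦ (.run c, [z], none)) '' M.start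
  | .run c, some (.sym a), z =>
    (fun r ↦ (.run r.1, r.2.1.map some ++ bottomOf z, r.2.2)) '' M.move c z a
  | .run c, some .right, z => {r | M.finish c z ∧ r = (.accept, [z], none)}
  | _, _, _ => ∅

theorem finite_trans (M : RealTime S G) (q : State M.C) (a : Option (Tape S)) (z : Option M.Z) :
    (M.trans q a z).Finite := by
  have := M.finC
  rcases a with _ | _ | a | _ <;> cases q
  all_goals first
    | exact Set.finite_singleton _
    | exact Set.finite_empty
    | exact (Set.toFinite M.start).image _
    | exact (M.finite_move _ _ _).image _
    | exact (Set.finite_singleton _).subset fun _ h ↦ h.2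

/-- A real-time machine as an npda. -/
abbrev toNPDA (M : RealTime S G) : NPDA S G where
  Q := State M.C
  Stk := Option M.Z
  finQ := have := M.finC; inferInstance
  finStk := have := M.finZ; inferInstance
  start := .start
  bottom := none
  acc := {.accept}
  rej := {.reject}
  disj := Set.disjoint_singleton.2 (by nofun)
  trans := M.trans
  finTrans := M.finite_trans

variable {M : RealTime S G}

theorem start_notMem_halt : State.start ∉ M.toNPDA.halt := by rintro (h | h) <;> cases h

theorem run_notMem_halt (c : M.C) : State.run c ∉ M.toNPDA.halt := by rintro (h | h) <;> cases h

variable (M) in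
/-- What holds after `n` steps of `M.toNPDA` on `x`. -/
inductive Inv (x : List S) : ℕ → M.toNPDA.Config → Prop
  | start : Inv x 0 (M.toNPDA.init x)
  | run {u₁ u₂ : List S} {c : M.C} {γ : List M.Z} {y : List G} : x = u₁ ++ u₂ →
      (∀ y' ∈ M.outputsFrom c γ u₂, y ++ y' ∈ M.outputs x) →
      Inv x (u₁.length + 1) ⟨.run c, u₂.map .sym ++ [.right], withBottom γ, y⟩
  | reject {n : ℕ} {u : List (Tape S)} {γ : List (Option M.Z)} {y : List G} :
      n ≤ x.length + 2 → Inv x n ⟨.reject, u, γ, y⟩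
  | accept {u : List (Tape S)} {γ : List (Option M.Z)} {y : List G} : y ∈ M.outputs x →
      Inv x (x.length + 2) ⟨.accept, u, γ, y⟩

theorem Inv.step_run {u₁ u₂ : List S} {c : M.C} {γ : List M.Z} {y : List G}
    {b : M.toNPDA.Config}
    (hy : ∀ y' ∈ M.outputsFrom c γ u₂, y ++ y' ∈ M.outputs (u₁ ++ u₂))
    (hs : M.toNPDA.Step ⟨.run c, u₂.map .sym ++ [.right], withBottom γ, y⟩ b) :
    M.Inv (u₁ ++ u₂) (u₁.length + 1 + 1) b := by
  obtain ⟨-, a, u', Z, v, p, w, o, hu, hγ, ht, rfl⟩ := hs.exists_trans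
  obtain ⟨v', hv, hv'⟩ := withBottom_eq_cons γ
  obtain ⟨rfl, rfl⟩ := List.cons.inj (hv.symm.trans hγ)
  rcases a with _ | _ | a | _
  · cases ht
    exact .reject (by rw [List.length_append]; omega)
  · cases ht
  · obtain ⟨r, hr, h⟩ := ht
    cases h
    obtain _ | ⟨b, u₂⟩ := u₂
    · simp at hu
    obtain ⟨rfl, rfl⟩ : b = a ∧ u₂.map .sym ++ [.right] = u' := by simpa using hu
    rw [List.append_assoc, hv', map_some_append_withBottom]
    simpa using Inv.run (M := M) (u₁ := u₁ ++ [b]) (u₂ := u₂) (γ := r.2.1 ++ γ.tail)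
      (y := y ++ r.2.2.toList) rfl fun y' hy' ↦ by simpa using hy _ ⟨r, hr, y', hy', rfl⟩
  · obtain ⟨hf, h⟩ := ht
    cases h
    obtain _ | ⟨b, u₂⟩ := u₂
    · simpa using Inv.accept (M := M) (u := u') (γ := [γ.head?] ++ v') (hy [] ⟨rfl, hf⟩)
    · simp at hu

theorem Inv.step {x : List S} {n : ℕ} {b c : M.toNPDA.Config} (h : M.Inv x n b)
    (hs : M.toNPDA.Step b c) : M.Inv x (n + 1) c := by
  cases h with
  | start =>
    obtain ⟨-, a, u', Z, v, p, w, o, hu, hγ, ht, rfl⟩ := hs.exists_trans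
    rcases a with _ | _ | a | _
    · cases ht
      exact .reject (by omega)
    · obtain ⟨c, hc, hr⟩ := ht
      cases hr
      cases hu
      cases hγ
      exact .run (u₁ := []) (γ := []) rfl fun y' hy' ↦ ⟨c, hc, hy'⟩
    · cases ht
    · cases ht
  | run hx hy =>
    subst hx
    exact step_run hy hs
  | reject => exact absurd (.inr rfl) hs.exists_trans.1
  | accept => exact absurd (.inl rfl) hs.exists_trans.1

theorem step_sym {c : M.C} {γ : List M.Z} {a : S} {u : List (Tape S)} {y : List G}
    {r : M.C × List M.Z × Option G} (hr : r ∈ M.move c γ.head? a) :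
    M.toNPDA.Step ⟨.run c, .sym a :: u, withBottom γ, y⟩
      ⟨.run r.1, u, withBottom (r.2.1 ++ γ.tail), y ++ r.2.2.toList⟩ := by
  obtain ⟨v, hv, hv'⟩ := withBottom_eq_cons γ
  rw [hv, ← map_some_append_withBottom, ← hv', ← List.append_assoc]
  exact .read (run_notMem_halt c) ⟨r, hr, rfl⟩

theorem exists_stepsIn_accept {u : List S} {c : M.C} {γ : List M.Z} {y : List G}
    (h : y ∈ M.outputsFrom c γ u) (y₀ : List G) :
    ∃ n δ, StepsIn M.toNPDA.Step ⟨.run c, u.map .sym ++ [.right], withBottom γ, y₀⟩ n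
      ⟨.accept, [], δ, y₀ ++ y⟩ := by
  induction u generalizing c γ y y₀ with
  | nil =>
    obtain ⟨rfl, hf⟩ := h
    obtain ⟨v, hv, -⟩ := withBottom_eq_cons γ
    rw [hv]
    exact ⟨1, _, StepsIn.refl.tail (.read (run_notMem_halt c) (o := none) ⟨hf, rfl⟩)⟩
  | cons a u ih =>
    obtain ⟨r, hr, y', hy', rfl⟩ := h
    obtain ⟨n, δ, hn⟩ := ih hy' (y₀ ++ r.2.2.toList)
    rw [List.append_assoc] at hn
    exact ⟨n + 1, δ, hn.head (step_sym hr)⟩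

variable (M)

theorem toNPDA_terminates : M.toNPDA.Terminates := by
  refine ⟨1, 2, fun x n c h ↦ ?_⟩
  obtain _ | @⟨u₁, u₂, c, γ, y, rfl, -⟩ | hn | - := h.invariant (P := M.Inv x) .start .step
  · exact ⟨by omega, .inr ⟨_, .stay start_notMem_halt (o := none) rfl⟩⟩
  · obtain ⟨v, hv, -⟩ := withBottom_eq_cons γ
    rw [hv]
    refine ⟨?_, .inr ⟨_, .stay (run_notMem_halt c) (o := none) rfl⟩⟩
    rw [List.length_append]
    omega
  · exact ⟨by omega, .inl (.inr rfl)⟩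
  · exact ⟨by omega, .inl (.inl rfl)⟩

theorem outputs_toNPDA (x : List S) : M.toNPDA.outputs x = M.outputs x := by
  ext y
  constructor
  · rintro ⟨n, c, h, hc, rfl⟩
    obtain _ | _ | _ | hy := h.invariant (P := M.Inv x) .start .step <;>
      first | exact hy | cases hc
  · rintro ⟨c, hc, hy⟩
    obtain ⟨n, δ, h⟩ := exists_stepsIn_accept hy []
    exact ⟨n + 1, _, h.head (.read start_notMem_halt (o := none) ⟨c, hc, rfl⟩), rfl, rfl⟩

end RealTime

/-! ### The separating function is an optimum -/

/-- The separator that ends block `k` of a word of the form `palWord x y`. -/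
def palSep : Fin 6 → Option PalSym
  | 2 => some .hash
  | 5 => none
  | _ => some .nat

/-- The moves of `palMachine`.  In control `some (i, k)` the machine is inside block `k`; it pushes
block `i`, compares block `i + 3` with the stack, and copies these two blocks to the output.  In
control `none` it skips the word. -/
def palMove : Option (Fin 3 × Fin 6) → Option Bool → PalSym →
    Set (Option (Fin 3 × Fin 6) × List Bool × Option Bool)
  | none, z, _ => {(none, z.toList, none)}
  | some (i, k), z, .bit b =>
    if k.val = i.val then {(some (i, k), b :: z.toList, some b)}
    else if k.val = i.val + 3 then {r | z = some b ∧ r = (some (i, k), [], some b)}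
    else {(some (i, k), z.toList, none)}
  | some (i, k), z, c => {r | palSep k = some c ∧ r = (some (i, k + 1), z.toList, none)}

theorem finite_palMove (c : Option (Fin 3 × Fin 6)) (z : Option Bool) (a : PalSym) :
    (palMove c z a).Finite := by
  rcases c with _ | ⟨i, k⟩ <;> cases a <;> simp only [palMove] <;> (try split_ifs) <;>
    first
    | exact Set.finite_singleton _
    | exact (Set.finite_singleton _).subset fun _ h ↦ h.2

/-- A real-time machine whose outputs are those described by `palPairs`. -/
abbrev palMachine : RealTime PalSym Bool where
  C := Option (Fin 3 × Fin 6)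
  Z := Bool
  finC := inferInstance
  finZ := inferInstance
  start := {none} ∪ {c | ∃ i, c = some (i, 0)}
  move := palMove
  finite_move := finite_palMove
  finish
    | none, _ => True
    | some (_, k), z => palSep k = none ∧ z = none

namespace palMachine

variable {i : Fin 3} {k : Fin 6} {γ : List Bool} {u : List PalSym} {y : List Bool}

theorem bits_cons_append (b : Bool) (x : List Bool) :
    bits (b :: x) ++ u = .bit b :: (bits x ++ u) := rfl

theorem mem_outputsFrom_none_iff : y ∈ palMachine.outputsFrom none γ u ↔ y = [] := by
  induction u generalizing γ y with
  | nil => simp [RealTime.outputsFrom]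
  | cons a u ih => simp [RealTime.outputsFrom, palMove, ih]

theorem mem_outputsFrom_nil_iff :
    y ∈ palMachine.outputsFrom (some (i, k)) γ [] ↔ y = [] ∧ palSep k = none ∧ γ = [] := by
  simp [RealTime.outputsFrom]

theorem mem_outputsFrom_nat_cons_iff : y ∈ palMachine.outputsFrom (some (i, k)) γ (.nat :: u) ↔
    palSep k = some .nat ∧ y ∈ palMachine.outputsFrom (some (i, k + 1)) γ u := by
  simp [RealTime.outputsFrom, palMove, toList_head?_append_tail]

theorem mem_outputsFrom_hash_cons_iff : y ∈ palMachine.outputsFrom (some (i, k)) γ (.hash :: u) ↔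
    palSep k = some .hash ∧ y ∈ palMachine.outputsFrom (some (i, k + 1)) γ u := by
  simp [RealTime.outputsFrom, palMove, toList_head?_append_tail]

theorem mem_outputsFrom_bit_cons_iff_of_push (hk : k.val = i.val) {b : Bool} :
    y ∈ palMachine.outputsFrom (some (i, k)) γ (.bit b :: u) ↔
      ∃ y' ∈ palMachine.outputsFrom (some (i, k)) (b :: γ) u, y = b :: y' := by
  simp [RealTime.outputsFrom, palMove, hk, toList_head?_append_tail]

theorem mem_outputsFrom_bit_cons_iff_of_pop (hk : k.val = i.val + 3) {b : Bool} :
    y ∈ palMachine.outputsFrom (some (i, k)) γ (.bit b :: u) ↔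
      ∃ γ', γ = b :: γ' ∧ ∃ y' ∈ palMachine.outputsFrom (some (i, k)) γ' u, y = b :: y' := by
  cases γ <;> simp [RealTime.outputsFrom, palMove, hk, and_assoc]

theorem mem_outputsFrom_bit_cons_iff_of_skip (hk : k.val ≠ i.val) (hk' : k.val ≠ i.val + 3)
    {b : Bool} : y ∈ palMachine.outputsFrom (some (i, k)) γ (.bit b :: u) ↔
      y ∈ palMachine.outputsFrom (some (i, k)) γ u := by
  simp [RealTime.outputsFrom, palMove, hk, hk', toList_head?_append_tail]

theorem mem_outputsFrom_bits_append_iff_of_push (hk : k.val = i.val) {x : List Bool} :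
    y ∈ palMachine.outputsFrom (some (i, k)) γ (bits x ++ u) ↔
      ∃ y' ∈ palMachine.outputsFrom (some (i, k)) (x.reverse ++ γ) u, y = x ++ y' := by
  induction x generalizing γ y with
  | nil => simp [bits]
  | cons b x ih => simp [bits_cons_append, mem_outputsFrom_bit_cons_iff_of_push hk, ih]

theorem mem_outputsFrom_bits_append_iff_of_pop (hk : k.val = i.val + 3) {x : List Bool} :
    y ∈ palMachine.outputsFrom (some (i, k)) γ (bits x ++ u) ↔
      ∃ γ', γ = x ++ γ' ∧ ∃ y' ∈ palMachine.outputsFrom (some (i, k)) γ' u, y = x ++ y' := by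
  induction x generalizing γ y with
  | nil => simp [bits]
  | cons b x ih =>
    simp only [bits_cons_append, mem_outputsFrom_bit_cons_iff_of_pop hk, ih]
    constructor
    · rintro ⟨_, rfl, _, ⟨γ', rfl, y', hy', rfl⟩, rfl⟩
      exact ⟨γ', rfl, y', hy', rfl⟩
    · rintro ⟨γ', rfl, y', hy', rfl⟩
      exact ⟨_, rfl, _, ⟨γ', rfl, y', hy', rfl⟩, rfl⟩

theorem mem_outputsFrom_bits_append_iff_of_skip (hk : k.val ≠ i.val) (hk' : k.val ≠ i.val + 3)
    {x : List Bool} : y ∈ palMachine.outputsFrom (some (i, k)) γ (bits x ++ u) ↔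
      y ∈ palMachine.outputsFrom (some (i, k)) γ u := by
  induction x with
  | nil => rfl
  | cons b x ih => rw [bits_cons_append, mem_outputsFrom_bit_cons_iff_of_skip hk hk', ih]

theorem mem_outputsFrom_bits_iff_of_pop (hk : k.val = i.val + 3) (hk' : palSep k = none)
    {x : List Bool} : y ∈ palMachine.outputsFrom (some (i, k)) γ (bits x) ↔ γ = x ∧ y = x := by
  simpa [mem_outputsFrom_nil_iff, hk'] using
    mem_outputsFrom_bits_append_iff_of_pop (u := []) (γ := γ) (y := y) (x := x) hk

theorem mem_outputsFrom_bits_iff_of_skip (hk : k.val ≠ i.val) (hk' : k.val ≠ i.val + 3)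
    (hk'' : palSep k = none) {x : List Bool} :
    y ∈ palMachine.outputsFrom (some (i, k)) γ (bits x) ↔ γ = [] ∧ y = [] := by
  simpa [mem_outputsFrom_nil_iff, hk'', and_comm] using
    mem_outputsFrom_bits_append_iff_of_skip (u := []) (γ := γ) (y := y) (x := x) hk hk'

theorem exists_mem_outputsFrom_of_bit_cons {b : Bool}
    (h : y ∈ palMachine.outputsFrom (some (i, k)) γ (.bit b :: u)) :
    ∃ γ' y', y' ∈ palMachine.outputsFrom (some (i, k)) γ' u := by
  by_cases hk : k.val = i.val
  · obtain ⟨y', hy', -⟩ := (mem_outputsFrom_bit_cons_iff_of_push hk).1 h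
    exact ⟨_, y', hy'⟩
  by_cases hk' : k.val = i.val + 3
  · obtain ⟨γ', -, y', hy', -⟩ := (mem_outputsFrom_bit_cons_iff_of_pop hk').1 h
    exact ⟨γ', y', hy'⟩
  · exact ⟨γ, y, (mem_outputsFrom_bit_cons_iff_of_skip hk hk').1 h⟩

theorem exists_eq_bits_append_cons {c : PalSym} (hk : palSep k = some c)
    (h : y ∈ palMachine.outputsFrom (some (i, k)) γ u) :
    ∃ x r γ' y', u = bits x ++ c :: r ∧ y' ∈ palMachine.outputsFrom (some (i, k + 1)) γ' r := by
  induction u generalizing γ y with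
  | nil => simp [mem_outputsFrom_nil_iff, hk] at h
  | cons a u ih =>
    cases a with
    | bit b =>
      obtain ⟨γ', y', h'⟩ := exists_mem_outputsFrom_of_bit_cons h
      obtain ⟨x, r, γ'', y'', rfl, h''⟩ := ih h'
      exact ⟨b :: x, r, γ'', y'', rfl, h''⟩
    | nat =>
      obtain ⟨hc, h⟩ := mem_outputsFrom_nat_cons_iff.1 h
      cases hk.symm.trans hc
      exact ⟨[], u, γ, y, rfl, h⟩
    | hash =>
      obtain ⟨hc, h⟩ := mem_outputsFrom_hash_cons_iff.1 h
      cases hk.symm.trans hc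
      exact ⟨[], u, γ, y, rfl, h⟩

theorem exists_eq_bits (hk : palSep k = none)
    (h : y ∈ palMachine.outputsFrom (some (i, k)) γ u) : ∃ x, u = bits x := by
  induction u generalizing γ y with
  | nil => exact ⟨[], rfl⟩
  | cons a u ih =>
    cases a with
    | bit b =>
      obtain ⟨γ', y', h'⟩ := exists_mem_outputsFrom_of_bit_cons h
      obtain ⟨x, rfl⟩ := ih h'
      exact ⟨b :: x, rfl⟩
    | nat => simp [mem_outputsFrom_nat_cons_iff, hk] at h
    | hash => simp [mem_outputsFrom_hash_cons_iff, hk] at h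

theorem exists_eq_palWord (h : y ∈ palMachine.outputsFrom (some (i, 0)) γ u) :
    ∃ x y, u = palWord x y := by
  obtain ⟨x₀, _, _, _, rfl, h₀⟩ := exists_eq_bits_append_cons rfl h
  obtain ⟨x₁, _, _, _, rfl, h₁⟩ := exists_eq_bits_append_cons rfl h₀
  obtain ⟨x₂, _, _, _, rfl, h₂⟩ := exists_eq_bits_append_cons rfl h₁
  obtain ⟨y₀, _, _, _, rfl, h₃⟩ := exists_eq_bits_append_cons rfl h₂
  obtain ⟨y₁, _, _, _, rfl, h₄⟩ := exists_eq_bits_append_cons rfl h₃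
  obtain ⟨y₂, rfl⟩ := exists_eq_bits rfl h₄
  exact ⟨![x₀, x₁, x₂], ![y₀, y₁, y₂], by simp [palWord]⟩

theorem mem_outputsFrom_palWord_iff {x y : Fin 3 → List Bool} {s : List Bool} :
    s ∈ palMachine.outputsFrom (some (i, 0)) [] (palWord x y) ↔
      x i = (y i).reverse ∧ s = x i ++ y i := by
  fin_cases i <;>
    simp [palWord, palSep, mem_outputsFrom_bits_append_iff_of_push,
      mem_outputsFrom_bits_append_iff_of_pop, mem_outputsFrom_bits_append_iff_of_skip,
      mem_outputsFrom_nat_cons_iff, mem_outputsFrom_hash_cons_iff,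
      mem_outputsFrom_bits_iff_of_pop, mem_outputsFrom_bits_iff_of_skip, List.reverse_eq_iff]

end palMachine

theorem outputs_palMachine (w : List PalSym) : palMachine.outputs w = palPairs w := by
  ext s
  constructor
  · rintro ⟨c, rfl | ⟨i, rfl⟩, h⟩
    · exact .inl (palMachine.mem_outputsFrom_none_iff.1 h)
    · obtain ⟨x, y, rfl⟩ := palMachine.exists_eq_palWord h
      exact .inr ⟨x, y, rfl, i, palMachine.mem_outputsFrom_palWord_iff.1 h⟩
  · rintro (rfl | ⟨x, y, rfl, i, h⟩)
    · exact ⟨none, .inl rfl, palMachine.mem_outputsFrom_none_iff.2 rfl⟩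
    · exact ⟨some (i, 0), .inr ⟨i, rfl⟩, palMachine.mem_outputsFrom_palWord_iff.2 h⟩

theorem palPairs_finite (w : List PalSym) : (palPairs w).Finite := by
  refine (List.finite_length_le Bool w.length).subset ?_
  rintro s (rfl | ⟨x, y, rfl, i, -, rfl⟩)
  · simp
  · fin_cases i <;> simp [bits] <;> omega

theorem exists_isDictMax_palPairs (w : List PalSym) :
    ∃ y, IsDictMax inferInstance (palPairs w) y := by
  obtain ⟨y, hy, hmax⟩ := Set.exists_max_image (palPairs w) id (palPairs_finite w) ⟨[], .inl rfl⟩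
  exact ⟨y, hy, fun z hz ↦ (hmax z hz).eq_or_lt⟩

theorem not_lex_of_eq_or_lex {H : Type} (r : H → H → Prop) [Std.Asymm r] {y z : List H}
    (h : y = z ∨ List.Lex r y z) : ¬List.Lex r z y := by
  obtain rfl | h := h
  · exact irrefl _
  · exact asymm h

theorem IsDictMax.unique {G : Type} {ord : LinearOrder G} {Y : Set (List G)} {y z : List G}
    (hy : IsDictMax ord Y y) (hz : IsDictMax ord Y z) : z = y :=
  (hy.2 z hz.1).resolve_right (not_lex_of_eq_or_lex _ (hz.2 y hy.1))

theorem maxPalPair_mem_OptCFL : maxPalPair ∈ OptCFL := by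
  refine ⟨palMachine.toNPDA, palMachine.toNPDA_terminates, .inl fun w ↦ ?_⟩
  obtain ⟨y, hy⟩ := exists_isDictMax_palPairs w
  refine ⟨y, Set.eq_singleton_iff_unique_mem.2 ⟨hy, fun z hz ↦ hy.unique hz⟩, ?_⟩
  exact ((palMachine.outputs_toNPDA w).trans (outputs_palMachine w)).symm ▸ hy

/-! ### Guided simulation of an npda by an oracle npda -/

namespace OracleNPDA

variable {S D G : Type} {M : OracleNPDA S D G} {A : Language D}

theorem Step.of_trans {q p : M.Q} {a : Option (Tape S)} {u : List (Tape S)} {Z : M.Stk}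
    {v w : List M.Stk} {d : Option D} {o : Option G} {s : List D} {y : List G}
    (hq : q ∉ M.halt) (hq' : q ≠ M.query) (ht : (p, w, d, o) ∈ M.trans q a Z) :
    M.Step A ⟨q, a.toList ++ u, Z :: v, s, y⟩
      ⟨p, u, w ++ v, s ++ d.toList, y ++ o.toList⟩ := by
  cases a with
  | none => exact .stay hq hq' ht
  | some a => exact .read hq hq' ht

theorem Step.exists_trans_or_query {q : M.Q} {u : List (Tape S)} {γ : List M.Stk} {s : List D}
    {y : List G} {c : M.Config} (h : M.Step A ⟨q, u, γ, s, y⟩ c) :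
    (q ∉ M.halt ∧ q ≠ M.query ∧ ∃ a u' Z v p w d o, u = a.toList ++ u' ∧ γ = Z :: v ∧
      (p, w, d, o) ∈ M.trans q a Z ∧ c = ⟨p, u', w ++ v, s ++ d.toList, y ++ o.toList⟩) ∨
    (q = M.query ∧ (s ∈ A ∧ c = ⟨M.yes, u, γ, [], y⟩ ∨ s ∉ A ∧ c = ⟨M.no, u, γ, [], y⟩)) := by
  cases h with
  | stay hq hq' ht => exact .inl ⟨hq, hq', none, _, _, _, _, _, _, _, rfl, rfl, ht, rfl⟩
  | read hq hq' ht => exact .inl ⟨hq, hq', some _, _, _, _, _, _, _, _, rfl, rfl, ht, rfl⟩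
  | ask_yes hs => exact .inr ⟨rfl, .inl ⟨hs, rfl⟩⟩
  | ask_no hs => exact .inr ⟨rfl, .inr ⟨hs, rfl⟩⟩

theorem accepts_iff_nonempty_outputs {x : List S} : M.Accepts A x ↔ (M.outputs A x).Nonempty :=
  ⟨fun ⟨n, c, h, hc⟩ ↦ ⟨c.output, n, c, h, hc, rfl⟩, fun ⟨_, n, c, h, hc, _⟩ ↦ ⟨n, c, h, hc⟩⟩

end OracleNPDA

/-- The input symbols on a piece of the tape. -/
def symsOf {S : Type} (u : List (Tape S)) : List S :=
  u.filterMap fun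
    | .sym a => some a
    | _ => none

/-- Whether a tape symbol is the right endmarker. -/
def Tape.isRight {S : Type} : Tape S → Bool
  | .right => true
  | _ => false

/-- A partial map of symbols, extended to the endmarkers. -/
def projTape {T S : Type} (f : T → Option S) : Tape T → Option (Tape S)
  | .left => some .left
  | .sym t => (f t).map .sym
  | .right => some .right

theorem symsOf_append {S : Type} (u v : List (Tape S)) : symsOf (u ++ v) = symsOf u ++ symsOf v :=
  List.filterMap_append

theorem symsOf_tapeOf {S : Type} (x : List S) : symsOf (tapeOf x) = x := by
  have hsyms : symsOf (x.map Tape.sym) = x := by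
    rw [symsOf, List.filterMap_map]
    exact List.filterMap_some
  change symsOf (x.map Tape.sym ++ [.right]) = x
  rw [symsOf_append, hsyms]
  exact List.append_nil x

theorem filterMap_projTape_tapeOf {T S : Type} (f : T → Option S) (t : List T) :
    (tapeOf t).filterMap (projTape f) = tapeOf (t.filterMap f) := by
  have hsyms : (t.map Tape.sym).filterMap (projTape f) = (t.filterMap f).map Tape.sym := by
    rw [List.filterMap_map, List.map_filterMap]
    rfl
  simp [tapeOf, List.filterMap_append, hsyms, projTape]

theorem length_tapeOf {S : Type} (x : List S) : (tapeOf x).length = x.length + 2 := by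
  simp [tapeOf]

theorem isRight_eq_isEmpty_of_tapeOf_eq {S : Type} {x : List S} {u v : List (Tape S)} {a : Tape S}
    (h : tapeOf x = u ++ a :: v) : a.isRight = v.isEmpty := by
  replace h : (Tape.left :: x.map Tape.sym) ++ [Tape.right] = u ++ a :: v := h
  obtain rfl | ⟨v, b, rfl⟩ := List.eq_nil_or_concat v
  · obtain rfl : Tape.right = a := by simpa using (List.append_inj' h rfl).2
    rfl
  · have hx : Tape.left :: x.map Tape.sym = u ++ a :: v :=
      (List.append_inj' (h.trans (by simp) : _ = (u ++ a :: v) ++ [b]) rfl).1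
    have ha : a ∈ Tape.left :: x.map Tape.sym := by simp [hx]
    cases a <;> simp [Tape.isRight] at ha ⊢

/-- A finite control accompanying the simulation of an npda with input alphabet `S` and output
alphabet `H` by an oracle npda with input alphabet `T`: each input symbol is translated into a
symbol of `S` or ignored, and the control reacts to the input symbols and to the output symbols of
the simulated machine by writing on the query tape and on the output tape. -/
structure Controller (S H T D G : Type) where
  C : Type
  finC : Finite C
  start : C
  proj : T → Option S
  onRead : C → T → Set (C × Option D)
  onWrite : C → H → Set (C × Option D × Option G)
  final : Set C

namespace Controller

variable {S H T D G : Type} (K : Controller S H T D G)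

/-- The reactions to a tape symbol: endmarkers are ignored. -/
def read (c : K.C) : Tape T → Set (K.C × Option D)
  | .sym t => K.onRead c t
  | _ => {(c, none)}

/-- The reactions to a move of the simulated machine, which may write nothing. -/
def write (c : K.C) : Option H → Set (K.C × Option D × Option G)
  | some h => K.onWrite c h
  | none => {(c, none, none)}

/-- `K.Reacts t z c s g`: while `t` is read and the simulated machine writes `z`, in some
interleaving, the control can move to `c`, writing `s` on the query tape and `g` on the output
tape. -/
inductive Reacts : List T → List H → K.C → List D → List G → Prop
  | init : Reacts [] [] K.start [] []
  | onRead {t z c s g a c' d} : Reacts t z c s g → (c', d) ∈ K.onRead c a →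
      Reacts (t ++ [a]) z c' (s ++ d.toList) g
  | onWrite {t z c s g a c' d o} : Reacts t z c s g → (c', d, o) ∈ K.onWrite c a →
      Reacts t (z ++ [a]) c' (s ++ d.toList) (g ++ o.toList)

/-- The control has a strategy that maintains `J`, whatever it has to react to. -/
structure Preservable (J : List T → List H → K.C → List D → List G → Prop) : Prop where
  init : J [] [] K.start [] []
  onRead : ∀ {t z c s g} (a), J t z c s g →
    ∃ c' d, (c', d) ∈ K.onRead c a ∧ J (t ++ [a]) z c' (s ++ d.toList) g
  onWrite : ∀ {t z c s g} (a), J t z c s g →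
    ∃ c' d o, (c', d, o) ∈ K.onWrite c a ∧ J t (z ++ [a]) c' (s ++ d.toList) (g ++ o.toList)

variable {K}

theorem Reacts.read {u : List (Tape T)} {z : List H} {c c' : K.C} {s : List D} {g : List G}
    {a : Tape T} {d : Option D} (h : K.Reacts (symsOf u) z c s g) (hc : (c', d) ∈ K.read c a) :
    K.Reacts (symsOf (u ++ [a])) z c' (s ++ d.toList) g := by
  rw [symsOf_append]
  cases a with
  | sym a => exact h.onRead hc
  | _ =>
    cases Set.mem_singleton_iff.1 hc
    simpa [symsOf] using h

theorem Reacts.write {t : List T} {z : List H} {c c' : K.C} {s : List D} {g : List G}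
    {a : Option H} {d : Option D} {o : Option G} (h : K.Reacts t z c s g)
    (hc : (c', d, o) ∈ K.write c a) :
    K.Reacts t (z ++ a.toList) c' (s ++ d.toList) (g ++ o.toList) := by
  cases a with
  | some a => exact h.onWrite hc
  | none =>
    cases Set.mem_singleton_iff.1 hc
    simpa using h

variable {J : List T → List H → K.C → List D → List G → Prop}

theorem Preservable.read (hJ : K.Preservable J) {u : List (Tape T)} {z : List H} {c : K.C}
    {s : List D} {g : List G} (a : Tape T) (h : J (symsOf u) z c s g) :
    ∃ c' d, (c', d) ∈ K.read c a ∧ J (symsOf (u ++ [a])) z c' (s ++ d.toList) g := by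
  rw [symsOf_append]
  cases a with
  | sym a => exact hJ.onRead a h
  | _ => exact ⟨c, none, rfl, by simpa [symsOf] using h⟩

theorem Preservable.write (hJ : K.Preservable J) {t : List T} {z : List H} {c : K.C}
    {s : List D} {g : List G} (a : Option H) (h : J t z c s g) :
    ∃ c' d o, (c', d, o) ∈ K.write c a ∧
      J t (z ++ a.toList) c' (s ++ d.toList) (g ++ o.toList) := by
  cases a with
  | some a => exact hJ.onWrite a h
  | none => exact ⟨c, none, none, rfl, by simpa using h⟩

/-- States of `Controller.sim`: `go q buf eof c` holds the state `q` of the simulated machine, a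
translated tape symbol that it has not read yet, whether the input is exhausted, and the control. -/
inductive State (Q S C : Type) : Type
  | start : State Q S C
  | go (q : Q) (buf : Option (Tape S)) (eof : Bool) (c : C) : State Q S C
  | query : State Q S C
  | yes : State Q S C
  | no : State Q S C
  | fail : State Q S C

instance State.finite {Q S C : Type} [Finite Q] [Finite S] [Finite C] : Finite (State Q S C) :=
  Set.finite_univ_iff.mp <|
    ((Set.finite_range fun r : Q × Option (Tape S) × Bool × C ↦
      State.go r.1 r.2.1 r.2.2.1 r.2.2.2).union
        (Set.toFinite {.start, .query, .yes, .no, .fail})).subset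
      fun q _ ↦ by cases q <;> simp

variable (K) (M : NPDA S H)

/-- Moves of `Controller.sim`.  In `simulate`, the simulated machine makes a move that reads `a`,
which is `none` or the symbol in the buffer. -/
inductive Move : State M.Q S K.C → Option (Tape T) → Option M.Stk →
    State M.Q S K.C × List (Option M.Stk) × Option D × Option G → Prop
  | start : Move .start none none
      (.go M.start none false K.start, [some M.bottom, none], none, none)
  | simulate {q p : M.Q} {a buf buf' : Option (Tape S)} {eof : Bool} {c c' : K.C} {Z : M.Stk}
      {w : List M.Stk} {o : Option H} {d : Option D} {g : Option G} : q ∉ M.halt →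
      (p, w, o) ∈ M.trans q a Z → buf.toList = a.toList ++ buf'.toList →
      (c', d, g) ∈ K.write c o →
      Move (.go q buf eof c) none (some Z) (.go p buf' eof c', w.map some, d, g)
  | fetch {q : M.Q} {buf : Option (Tape S)} {eof : Bool} {c c' : K.C} {t : Tape T}
      {Z : Option M.Stk} {d : Option D} : q ∈ M.acc ∨ buf = none → (c', d) ∈ K.read c t →
      Move (.go q buf eof c) (some t) Z (.go q (projTape K.proj t) t.isRight c', [Z], d, none)
  | ask {q : M.Q} {buf : Option (Tape S)} {c : K.C} {Z : Option M.Stk} : q ∈ M.acc →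
      c ∈ K.final → Move (.go q buf true c) none Z (.query, [Z], none, none)
  | fail {q : M.Q} {buf : Option (Tape S)} {eof : Bool} {c : K.C} {Z : Option M.Stk} :
      Move (.go q buf eof c) none Z (.fail, [Z], none, none)

theorem finite_move [Finite S] [Finite D] [Finite G] (q : State M.Q S K.C)
    (a : Option (Tape T)) (Z : Option M.Stk) : {r | K.Move M q a Z r}.Finite := by
  have := M.finQ
  have := M.finStk
  have := K.finC
  obtain ⟨L, hL⟩ := M.exists_push_bound
  refine ((Set.finite_univ (α := State M.Q S K.C)).prod
    ((List.finite_length_le (Option M.Stk) (L + 2)).prod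
      (Set.finite_univ (α := Option D × Option G)))).subset ?_
  rintro ⟨p, w, d, g⟩ h
  refine ⟨trivial, ?_, trivial⟩
  change w.length ≤ L + 2
  cases h with
  | simulate _ h _ _ =>
    have hw := hL _ _ _ _ h
    rw [List.length_map]
    exact Nat.le_add_right_of_le hw
  | _ => simp

/-- The machine that simulates `M` under the control `K`, asks one query when the simulated machine
has accepted and all of the input is read, and accepts if the answer is `yes`.  Its stack has an
extra bottom symbol, and it may give up at any time of the simulation. -/
abbrev sim [Finite S] [Finite D] [Finite G] : OracleNPDA T D G where
  Q := State M.Q S K.C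
  Stk := Option M.Stk
  finQ := have := M.finQ; have := K.finC; inferInstance
  finStk := have := M.finStk; inferInstance
  start := .start
  bottom := none
  acc := {.yes}
  rej := {.no, .fail}
  disj := Set.disjoint_singleton_left.2 (by simp)
  query := .query
  yes := .yes
  no := .no
  query_ne_yes := by simp
  query_ne_no := by simp
  yes_ne_no := by simp
  query_notMem := by simp
  trans q a Z := {r | K.Move M q a Z r}
  finTrans := K.finite_move M

variable {K M} [Finite S] [Finite D] [Finite G] {A : Language D} {t : List T}

theorem sim_step {q p : State M.Q S K.C} {a : Option (Tape T)} {u : List (Tape T)}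
    {Z : Option M.Stk} {v w : List (Option M.Stk)} {d : Option D} {o : Option G} {s : List D}
    {y : List G} (h : K.Move M q a Z (p, w, d, o)) :
    (K.sim M).Step A ⟨q, a.toList ++ u, Z :: v, s, y⟩
      ⟨p, u, w ++ v, s ++ d.toList, y ++ o.toList⟩ := by
  refine OracleNPDA.Step.of_trans ?_ ?_ h
  · cases h <;> simp [OracleNPDA.halt]
  · cases h <;> simp

variable (A t) in
/-- `Related A t b k c`: `b` and `c` can be the configurations of the simulated machine and of
`K.sim M` after some number of moves on input `t`, of which exactly `k` moves of `K.sim M` were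
not simulation moves. -/
inductive Related : M.Config → ℕ → (K.sim M).Config → Prop
  | start : Related (M.init (t.filterMap K.proj)) 0 ((K.sim M).init t)
  | go {q : M.Q} {u : List (Tape S)} {γ : List M.Stk} {z : List H} {buf : Option (Tape S)}
      {c : K.C} {used rest : List (Tape T)} {s : List D} {g : List G} :
      tapeOf t = used ++ rest →
      (q ∉ M.acc → u = buf.toList ++ rest.filterMap (projTape K.proj)) →
      K.Reacts (symsOf used) z c s g →
      Related ⟨q, u, γ, z⟩ (used.length + 1) ⟨.go q buf rest.isEmpty c, rest, withBottom γ, s, g⟩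
  | query {b : M.Config} {c : K.C} {v : List (Option M.Stk)} {s : List D} {g : List G} :
      b.state ∈ M.acc → K.Reacts t b.output c s g → c ∈ K.final →
      Related b (t.length + 4) ⟨.query, [], v, s, g⟩
  | yes {b : M.Config} {c : K.C} {v : List (Option M.Stk)} {s : List D} {g : List G} :
      b.state ∈ M.acc → K.Reacts t b.output c s g → c ∈ K.final → s ∈ A →
      Related b (t.length + 5) ⟨.yes, [], v, [], g⟩
  | reject {b : M.Config} {k : ℕ} {c : (K.sim M).Config} : c.state ∈ (K.sim M).rej →
      k ≤ t.length + 5 → Related b k c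

theorem Related.le {b : M.Config} {k : ℕ} {c : (K.sim M).Config} (h : Related A t b k c) :
    k ≤ t.length + 5 := by
  cases h with
  | go ht _ _ =>
    have hlen := length_tapeOf t
    rw [ht, List.length_append] at hlen
    omega
  | reject _ hk => exact hk
  | _ => omega

theorem withBottom_eq_some_cons {Z : Type} {γ : List Z} {z : Z} {v : List (Option Z)}
    (h : withBottom γ = some z :: v) : ∃ γ', γ = z :: γ' ∧ v = withBottom γ' := by
  cases γ with
  | nil => cases h
  | cons y γ =>
    obtain ⟨hy, rfl⟩ := List.cons.inj h
    exact ⟨γ, congrArg (· :: γ) (Option.some.inj hy), rfl⟩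

theorem Related.step_go {q : M.Q} {u : List (Tape S)} {γ : List M.Stk} {z : List H}
    {buf : Option (Tape S)} {c₀ : K.C} {used rest : List (Tape T)} {s : List D} {g : List G}
    {c : (K.sim M).Config} (ht : tapeOf t = used ++ rest)
    (hu : q ∉ M.acc → u = buf.toList ++ rest.filterMap (projTape K.proj))
    (hK : K.Reacts (symsOf used) z c₀ s g)
    (hs : (K.sim M).Step A ⟨.go q buf rest.isEmpty c₀, rest, withBottom γ, s, g⟩ c) :
    Related A t ⟨q, u, γ, z⟩ (used.length + 1 + 1) c ∨
      ∃ b, M.Step ⟨q, u, γ, z⟩ b ∧ Related A t b (used.length + 1) c := by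
  have hlen := length_tapeOf t
  rw [ht, List.length_append] at hlen
  generalize he : rest.isEmpty = eof at hs
  obtain ⟨-, -, a, u', Z, v, p, w, d, o, hr, hγ, hm, rfl⟩ | ⟨h, -⟩ := hs.exists_trans_or_query
  swap
  · cases h
  cases hm with
  | simulate hq htr hbuf hc =>
    obtain ⟨γ, rfl, rfl⟩ := withBottom_eq_some_cons hγ
    obtain rfl := hu fun h ↦ hq (.inl h)
    obtain rfl : rest = u' := hr
    rw [map_some_append_withBottom, hbuf, List.append_assoc, ← he]
    exact .inr ⟨_, .of_trans hq htr, .go ht (fun _ ↦ rfl) (hK.write hc)⟩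
  | @fetch _ _ _ _ _ a _ _ hq hc =>
    obtain rfl : rest = a :: u' := hr
    have hused : used.length + 1 = (used ++ [a]).length := by simp
    rw [List.singleton_append, ← hγ, Option.toList_none, List.append_nil,
      isRight_eq_isEmpty_of_tapeOf_eq ht, hused]
    refine .inl (.go (by simpa using ht) (fun h ↦ ?_) (hK.read hc))
    obtain rfl := hq.resolve_left h
    rw [hu h]
    cases ha : projTape K.proj a <;> simp [ha]
  | ask hq hc =>
    obtain rfl : rest = u' := hr
    obtain rfl : rest = [] := List.isEmpty_iff.1 he
    obtain rfl : tapeOf t = used := by simpa using ht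
    rw [symsOf_tapeOf] at hK
    rw [length_tapeOf]
    simpa using Or.inl (.query hq hK hc)
  | fail => exact .inl (.reject (.inr rfl) (by omega))

theorem Related.step {b : M.Config} {k : ℕ} {c c' : (K.sim M).Config} (h : Related A t b k c)
    (hs : (K.sim M).Step A c c') :
    Related A t b (k + 1) c' ∨ ∃ b', M.Step b b' ∧ Related A t b' k c' := by
  cases h with
  | start =>
    obtain ⟨-, -, a, u', Z, v, p, w, d, o, hu, hγ, hm, rfl⟩ | ⟨h, -⟩ := hs.exists_trans_or_query
    · cases hm
      obtain ⟨-, rfl⟩ := List.cons.inj hγ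
      obtain rfl : tapeOf t = u' := hu
      exact .inl (.go (γ := [M.bottom]) (used := []) rfl
        (fun _ ↦ (filterMap_projTape_tapeOf _ _).symm) .init)
    · cases h
  | go ht hu hK => exact step_go ht hu hK hs
  | query hb hK hc =>
    obtain ⟨-, h, -⟩ | ⟨-, ⟨hA, rfl⟩ | ⟨-, rfl⟩⟩ := hs.exists_trans_or_query
    · exact absurd rfl h
    · exact .inl (.yes hb hK hc hA)
    · exact .inl (.reject (.inl rfl) le_rfl)
  | yes =>
    obtain ⟨h, -⟩ | ⟨h, -⟩ := hs.exists_trans_or_query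
    · exact absurd (.inl rfl) h
    · cases h
  | reject hc =>
    obtain ⟨h, -⟩ | ⟨h, -⟩ := hs.exists_trans_or_query
    · exact absurd (.inr hc) h
    · exact absurd (h ▸ .inr hc) (K.sim M).query_notMem

theorem exists_related {n : ℕ} {c : (K.sim M).Config}
    (h : StepsIn ((K.sim M).Step A) ((K.sim M).init t) n c) :
    ∃ m k b, n = m + k ∧ StepsIn M.Step (M.init (t.filterMap K.proj)) m b ∧
      Related A t b k c := by
  induction h with
  | refl => exact ⟨0, 0, _, rfl, .refl, .start⟩
  | tail _ hs ih =>
    obtain ⟨m, k, b, rfl, hb, hR⟩ := ih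
    obtain hR | ⟨b', hs', hR⟩ := hR.step hs
    · exact ⟨m, k + 1, b, rfl, hb, hR⟩
    · exact ⟨m + 1, k, b', by omega, hb.tail hs', hR⟩

theorem sim_terminates (hM : M.Terminates) : (K.sim M).Terminates := by
  obtain ⟨a, b, hab⟩ := hM
  refine ⟨a + 1, b + 5, fun A t n c h ↦ ?_⟩
  obtain ⟨m, k, c₀, rfl, hm, hR⟩ := exists_related h
  constructor
  · calc m + k ≤ (a * (t.filterMap K.proj).length + b) + (t.length + 5) :=
          Nat.add_le_add (hab _ _ _ hm).1 hR.le
      _ ≤ (a * t.length + b) + (t.length + 5) := by gcongr; exact List.length_filterMap_le _ _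
      _ = (a + 1) * t.length + (b + 5) := by ring
  · cases hR with
    | start => exact .inr ⟨_, sim_step (a := none) .start⟩
    | @go _ _ γ =>
      obtain ⟨v, hv, -⟩ := withBottom_eq_cons γ
      rw [hv]
      exact .inr ⟨_, sim_step (a := none) .fail⟩
    | @query _ _ _ s =>
      by_cases hs : s ∈ A
      · exact .inr ⟨_, .ask_yes hs⟩
      · exact .inr ⟨_, .ask_no hs⟩
    | yes => exact .inl (.inl rfl)
    | reject hc => exact .inl (.inr hc)

theorem exists_of_mem_outputs_sim {g : List G} (h : g ∈ (K.sim M).outputs A t) :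
    ∃ z c s, z ∈ M.outputs (t.filterMap K.proj) ∧ K.Reacts t z c s g ∧ c ∈ K.final ∧ s ∈ A := by
  obtain ⟨n, c, hn, hc, rfl⟩ := h
  obtain ⟨m, k, b, -, hm, hR⟩ := exists_related hn
  cases hR with
  | yes hb hK hf hs => exact ⟨_, _, _, ⟨_, _, hm, hb, rfl⟩, hK, hf, hs⟩
  | reject h => exact absurd h (Set.disjoint_left.1 (K.sim M).disj hc)
  | _ => cases hc

variable {J : List T → List H → K.C → List D → List G → Prop}

variable (K M A t J) in
/-- Some path of `K.sim M` on input `t` that maintains `J` has read the part `used` of the tape,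
with `rest` remaining and `buf` in the buffer, and is simulating `M` in state `q` with stack `γ`
and output `z`. -/
def Reaches (q : M.Q) (γ : List M.Stk) (z : List H) (buf : Option (Tape S))
    (used rest : List (Tape T)) : Prop :=
  tapeOf t = used ++ rest ∧ ∃ n c s g, J (symsOf used) z c s g ∧
    StepsIn ((K.sim M).Step A) ((K.sim M).init t) n
      ⟨.go q buf rest.isEmpty c, rest, withBottom γ, s, g⟩

namespace Reaches

variable {q p : M.Q} {γ v w : List M.Stk} {z : List H} {buf buf' : Option (Tape S)}
  {used rest : List (Tape T)}

theorem start (hJ : K.Preservable J) :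
    K.Reaches M A t J M.start [M.bottom] [] none [] (tapeOf t) :=
  ⟨rfl, 1, K.start, [], [], hJ.init, StepsIn.refl.tail (sim_step (a := none) .start)⟩

theorem simulate (hJ : K.Preservable J) {a : Option (Tape S)} {Z : M.Stk} {o : Option H}
    (h : K.Reaches M A t J q (Z :: v) z buf used rest) (hq : q ∉ M.halt)
    (ht : (p, w, o) ∈ M.trans q a Z) (hbuf : buf.toList = a.toList ++ buf'.toList) :
    K.Reaches M A t J p (w ++ v) (z ++ o.toList) buf' used rest := by
  obtain ⟨hu, n, c, s, g, hj, hn⟩ := h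
  obtain ⟨c', d, e, hc, hj'⟩ := hJ.write o hj
  refine ⟨hu, n + 1, c', _, _, hj', hn.tail ?_⟩
  rw [← map_some_append_withBottom]
  exact sim_step (a := none) (.simulate hq ht hbuf hc)

theorem fetch (hJ : K.Preservable J) {b : Tape T}
    (h : K.Reaches M A t J q γ z buf used (b :: rest)) (hq : q ∈ M.acc ∨ buf = none) :
    K.Reaches M A t J q γ z (projTape K.proj b) (used ++ [b]) rest := by
  obtain ⟨hu, n, c, s, g, hj, hn⟩ := h
  obtain ⟨c', d, hc, hj'⟩ := hJ.read b hj
  refine ⟨by simpa using hu, n + 1, c', _, _, hj', hn.tail ?_⟩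
  obtain ⟨v, hv, -⟩ := withBottom_eq_cons γ
  have hs := sim_step (A := A) (u := rest) (Z := γ.head?) (v := v) (s := s) (y := g)
    (.fetch (M := M) (eof := false) hq hc)
  rw [isRight_eq_isEmpty_of_tapeOf_eq hu] at hs
  simpa [hv] using hs

theorem exists_buffer (hJ : K.Preservable J) {a : Tape S} {u : List (Tape S)}
    (h : K.Reaches M A t J q γ z none used rest)
    (hr : rest.filterMap (projTape K.proj) = a :: u) :
    ∃ used' rest', K.Reaches M A t J q γ z (some a) used' rest' ∧
      rest'.filterMap (projTape K.proj) = u := by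
  induction rest generalizing used with
  | nil => cases hr
  | cons b rest ih =>
    have hf := h.fetch hJ (.inr rfl)
    cases hb : projTape K.proj b with
    | none =>
      rw [hb] at hf
      exact ih hf (by rwa [List.filterMap_cons_none hb] at hr)
    | some a' =>
      rw [List.filterMap_cons_some hb] at hr
      obtain ⟨rfl, rfl⟩ := List.cons.inj hr
      exact ⟨_, rest, hb ▸ hf, rfl⟩

theorem exists_of_mem_acc (hJ : K.Preservable J) (h : K.Reaches M A t J q γ z buf used rest)
    (hq : q ∈ M.acc) : ∃ buf', K.Reaches M A t J q γ z buf' (tapeOf t) [] := by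
  induction rest generalizing used buf with
  | nil =>
    obtain rfl : tapeOf t = used := by simpa using h.1
    exact ⟨buf, h⟩
  | cons b rest ih => exact ih (h.fetch hJ (.inl hq))

theorem exists_of_stepsIn (hJ : K.Preservable J) {m : ℕ} {c : M.Config}
    (h : StepsIn M.Step (M.init (t.filterMap K.proj)) m c) :
    ∃ used rest, K.Reaches M A t J c.state c.stack c.output none used rest ∧
      c.input = rest.filterMap (projTape K.proj) := by
  induction h with
  | refl => exact ⟨_, _, start hJ, (filterMap_projTape_tapeOf _ _).symm⟩
  | @tail _ c _ _ hs ih =>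
    obtain ⟨used, rest, hR, hu⟩ := ih
    obtain ⟨q, u, γ, z⟩ := c
    obtain ⟨hq, a, u', Z, v, p, w, o, rfl, rfl, ht, rfl⟩ := hs.exists_trans
    cases a with
    | none => exact ⟨_, _, hR.simulate hJ hq ht rfl, hu⟩
    | some a =>
      obtain ⟨used', rest', hR', hr⟩ := hR.exists_buffer hJ hu.symm
      exact ⟨_, _, hR'.simulate hJ hq ht rfl, hr.symm⟩

end Reaches

theorem exists_mem_outputs_sim (hJ : K.Preservable J) {z : List H}
    (hz : z ∈ M.outputs (t.filterMap K.proj))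
    (hfin : ∀ c s g, J t z c s g → c ∈ K.final ∧ s ∈ A) :
    ∃ c s g, J t z c s g ∧ g ∈ (K.sim M).outputs A t := by
  obtain ⟨m, ⟨q, u, γ, z⟩, hm, hq, rfl⟩ := hz
  obtain ⟨used, rest, hR, -⟩ := Reaches.exists_of_stepsIn (A := A) hJ hm
  obtain ⟨buf, -, n, c, s, g, hj, hn⟩ := hR.exists_of_mem_acc hJ hq
  rw [symsOf_tapeOf] at hj
  obtain ⟨hc, hs⟩ := hfin c s g hj
  obtain ⟨v, hv, -⟩ := withBottom_eq_cons γ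
  rw [hv] at hn
  have hask : (K.sim M).Step A _ _ := sim_step (a := none) (u := []) (v := v) (s := s) (y := g)
    (.ask (buf := buf) (Z := γ.head?) hq hc)
  simp only [Option.toList_none, List.append_nil] at hask
  exact ⟨c, s, g, hj, n + 1 + 1, _, (hn.tail hask).tail (.ask_yes hs), rfl, rfl⟩

end Controller

/-- The control that ignores everything. -/
def idleController (S H D G : Type) : Controller S H S D G where
  C := Unit
  finC := inferInstance
  start := ()
  proj := some
  onRead _ _ := {((), none)}
  onWrite _ _ := {((), none, none)}
  final := Set.univ

theorem idleController_preservable {S H D G : Type} :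
    (idleController S H D G).Preservable fun _ _ _ s _ ↦ s = [] where
  init := rfl
  onRead _ h := ⟨(), none, rfl, by simpa using h⟩
  onWrite _ h := ⟨(), none, none, rfl, by simpa using h⟩

theorem mem_CFLT_of_forall_mem_iff {C : Set Lang} {A L : Lang} {H : Type} {M : NPDA L.Alph H}
    (hA : A ∈ C) (hnil : [] ∈ A.lang) (hM : M.Terminates)
    (hL : ∀ x, x ∈ L.lang ↔ (M.outputs x).Nonempty) : L ∈ CFLT C := by
  have := L.fin
  have := A.fin
  refine ⟨A, hA, (idleController L.Alph H A.Alph Empty).sim M, Controller.sim_terminates hM,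
    fun x ↦ ?_⟩
  have hx : x.filterMap (idleController L.Alph H A.Alph Empty).proj = x := List.filterMap_some
  rw [hL, OracleNPDA.accepts_iff_nonempty_outputs]
  constructor
  · rintro ⟨z, hz⟩
    obtain ⟨_, _, g, -, hg⟩ := Controller.exists_mem_outputs_sim idleController_preservable
      (A := A.lang) (hx.symm ▸ hz) fun _ _ _ hs ↦ ⟨trivial, hs ▸ hnil⟩
    exact ⟨g, hg⟩
  · rintro ⟨g, hg⟩
    obtain ⟨z, _, _, hz, -⟩ := Controller.exists_of_mem_outputs_sim hg
    exact ⟨z, hx ▸ hz⟩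

/-! ### Comparing two interleaved strings -/

/-- The symbols tagged with `b`. -/
def track {H : Type} (b : Bool) (s : List (Bool × H)) : List H :=
  s.filterMap fun p ↦ if p.1 = b then some p.2 else none

theorem track_append {H : Type} (b : Bool) (s t : List (Bool × H)) :
    track b (s ++ t) = track b s ++ track b t :=
  List.filterMap_append

theorem track_cons_self {H : Type} (b : Bool) (a : H) (s : List (Bool × H)) :
    track b ((b, a) :: s) = a :: track b s := by
  simp [track]

theorem track_cons_of_ne {H : Type} {b b' : Bool} (h : b' ≠ b) (a : H) (s : List (Bool × H)) :
    track b ((b', a) :: s) = track b s := by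
  simp [track, h]

/-- Two strings that differ, each presented on its own track. -/
def mismatchLang (H : Type) : Language (Bool × H) := {s | track false s ≠ track true s}

namespace RealTime

variable {S G : Type} {M : RealTime S G} {c : M.C} {γ : List M.Z}

theorem outputsFrom_nil_nonempty : (M.outputsFrom c γ []).Nonempty ↔ M.finish c γ.head? :=
  ⟨fun ⟨_, _, h⟩ ↦ h, fun h ↦ ⟨[], rfl, h⟩⟩

theorem outputsFrom_cons_nonempty {a : S} {u : List S} :
    (M.outputsFrom c γ (a :: u)).Nonempty ↔
      ∃ r ∈ M.move c γ.head? a, (M.outputsFrom r.1 (r.2.1 ++ γ.tail) u).Nonempty :=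
  ⟨fun ⟨_, r, hr, y, hy, _⟩ ↦ ⟨r, hr, y, hy⟩, fun ⟨r, hr, y, hy⟩ ↦ ⟨_, r, hr, y, hy, rfl⟩⟩

end RealTime

/-- Controls of `mismatchMachine`.  The stack of the machine in control `count` records which track
is ahead and by how many symbols; `find b a` has guessed a symbol `a` on track `b` and has to find a
different one at the same place of the other track, which is as many symbols ahead as the stack is
high. -/
inductive MismatchControl (H : Type) : Type
  | count : MismatchControl H
  | find (b : Bool) (a : H) : MismatchControl H
  | done : MismatchControl H

instance MismatchControl.finite {H : Type} [Finite H] : Finite (MismatchControl H) :=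
  Set.finite_univ_iff.mp <|
    ((Set.finite_range fun r : Bool × H ↦ MismatchControl.find r.1 r.2).union
      (Set.toFinite {.count, .done})).subset
      fun c _ ↦ by cases c <;> simp

open Classical in
/-- The moves of `mismatchMachine`. -/
def mismatchMove {H : Type} : MismatchControl H → Option Bool → Bool × H →
    Set (MismatchControl H × List Bool × Option Empty)
  | .count, z, (b, a) =>
    if z = some !b then {(.count, [], none)}
    else {(.count, b :: z.toList, none), (.find b a, z.toList, none)}
  | .find b a, z, (b', a') =>
    if b' = b then {(.find b a, z.toList, none)}
    else if z.isSome then {(.find b a, [], none)}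
    else if a' = a then ∅
    else {(.done, [], none)}
  | .done, _, _ => {(.done, [], none)}

theorem finite_mismatchMove {H : Type} (c : MismatchControl H) (z : Option Bool) (p : Bool × H) :
    (mismatchMove c z p).Finite := by
  cases c with
  | done => exact Set.finite_singleton _
  | _ => simp only [mismatchMove]; split_ifs <;> exact Set.toFinite _

/-- A real-time machine that accepts `mismatchLang H`. -/
abbrev mismatchMachine (H : Type) [Finite H] : RealTime (Bool × H) Empty where
  C := MismatchControl H
  Z := Bool
  finC := inferInstance
  finZ := inferInstance
  start := {.count}
  move := mismatchMove
  finite_move := finite_mismatchMove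
  finish
    | .count, z => z.isSome
    | .find _ _, _ => False
    | .done, _ => True

theorem cons_eq_drop_iff {H : Type} {y z : List H} {a : H} {k : ℕ} :
    (k ≤ z.length ∧ a :: y = z.drop k) ↔
      (k + 1 ≤ z.length ∧ y = z.drop (k + 1)) ∧ ∀ a', z[k]? = some a' → a' = a := by
  by_cases hk : k < z.length
  · simp only [List.drop_eq_getElem_cons hk, List.cons.injEq, List.getElem?_eq_getElem hk]
    grind
  · grind [List.drop_eq_nil_of_le]

namespace mismatchMachine

open RealTime

variable {H : Type} [Finite H]

theorem outputsFrom_done_nonempty (γ : List Bool) (u : List (Bool × H)) :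
    ((mismatchMachine H).outputsFrom .done γ u).Nonempty := by
  induction u generalizing γ with
  | nil => exact outputsFrom_nil_nonempty.2 trivial
  | cons a u ih => exact outputsFrom_cons_nonempty.2 ⟨_, rfl, ih _⟩

theorem outputsFrom_find_nonempty {b : Bool} {a : H} {γ : List Bool} {u : List (Bool × H)} :
    ((mismatchMachine H).outputsFrom (.find b a) γ u).Nonempty ↔
      ∃ a', (track (!b) u)[γ.length]? = some a' ∧ a' ≠ a := by
  induction u generalizing γ with
  | nil => simp [outputsFrom_nil_nonempty, track]
  | cons p u ih =>
    obtain ⟨b', a'⟩ := p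
    rw [outputsFrom_cons_nonempty]
    by_cases hb : b' = b
    · subst hb
      rw [track_cons_of_ne (by simp)]
      simp [mismatchMove, ih, toList_head?_append_tail]
    · obtain rfl : b' = !b := by cases b <;> simpa using hb
      rw [track_cons_self]
      cases γ with
      | cons z γ => simp [mismatchMove, ih]
      | nil => by_cases ha : a' = a <;> simp [mismatchMove, ha, outputsFrom_done_nonempty]

theorem outputsFrom_count_cons_nonempty {b : Bool} {a : H} {k : ℕ} {u : List (Bool × H)} :
    ((mismatchMachine H).outputsFrom .count (.replicate k b) ((b, a) :: u)).Nonempty ↔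
      ((mismatchMachine H).outputsFrom .count (.replicate (k + 1) b) u).Nonempty ∨
        ((mismatchMachine H).outputsFrom (.find b a) (.replicate k b) u).Nonempty := by
  rw [outputsFrom_cons_nonempty]
  cases k <;> simp [mismatchMove, List.replicate_succ]

theorem outputsFrom_count_nonempty {b : Bool} {k : ℕ} {u : List (Bool × H)} :
    ((mismatchMachine H).outputsFrom .count (.replicate k b) u).Nonempty ↔
      ¬(k ≤ (track (!b) u).length ∧ track b u = (track (!b) u).drop k) := by
  induction u generalizing b k with
  | nil => cases k <;> simp [outputsFrom_nil_nonempty, track]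
  | cons p u ih =>
    obtain ⟨b', a⟩ := p
    have ahead (k : ℕ) :
        ((mismatchMachine H).outputsFrom .count (.replicate k b') ((b', a) :: u)).Nonempty ↔
          ¬(k ≤ (track (!b') u).length ∧ a :: track b' u = (track (!b') u).drop k) := by
      rw [outputsFrom_count_cons_nonempty, ih, outputsFrom_find_nonempty, List.length_replicate,
        cons_eq_drop_iff, Classical.not_and_iff_not_or_not (a := _ ∧ _)]
      simp only [not_forall, exists_prop, ne_eq]
    by_cases hb : b' = b
    · subst hb
      rw [ahead, track_cons_self, track_cons_of_ne (by simp)]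
    obtain rfl : b' = !b := by cases b <;> simpa using hb
    rw [track_cons_self, track_cons_of_ne hb]
    cases k with
    | zero => simpa [eq_comm] using ahead 0
    | succ k =>
      rw [outputsFrom_cons_nonempty]
      simp [mismatchMove, List.replicate_succ, ih]

theorem outputs_nonempty {u : List (Bool × H)} :
    ((mismatchMachine H).outputs u).Nonempty ↔ u ∈ mismatchLang H := by
  have h := outputsFrom_count_nonempty (b := false) (k := 0) (u := u)
  have hu : u ∈ mismatchLang H ↔ track false u ≠ track true u := Iff.rfl
  simpa [outputs, hu, Set.Nonempty] using h

end mismatchMachine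

theorem isContextFree_zero (S : Type) : (0 : Language S).IsContextFree :=
  ⟨⟨Unit, (), ∅⟩, ContextFreeGrammar.language_eq_zero_of_forall_input_ne_initial (by simp)⟩

theorem mismatchLang_compl_mem_PiCFL (H : Type) [Finite H] :
    (⟨Bool × H, inferInstance, (mismatchLang H)ᶜ⟩ : Lang) ∈ PiCFL 2 := by
  have hA : (⟨Empty, inferInstance, (0 : Language Empty)ᶜ⟩ : Lang) ∈ PiCFL 1 := by
    change (0 : Language Empty)ᶜᶜ.IsContextFree
    rw [compl_compl]
    exact isContextFree_zero Empty
  refine mem_CFLT_of_forall_mem_iff hA (id : [] ∉ (0 : Language Empty))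
    (mismatchMachine H).toNPDA_terminates fun x ↦ ?_
  change x ∈ (mismatchLang H)ᶜᶜ ↔ _
  rw [compl_compl, RealTime.outputs_toNPDA, mismatchMachine.outputs_nonempty]

/-! ### Optimal outputs -/

section Marks

variable {H : Type}

/-- `m` is a mark in the string `y` after its prefix `p`: either `p` is `y` and `m` is `none`, or
`m` is the next symbol. -/
def Marked (m : Option H) (p y : List H) : Prop := p <+: y ∧ m = y[p.length]?

/-- Reactions to a symbol `a` of the string that goes to track `b`: before the mark is set, `a` is
either copied or marked, and afterwards `a` is ignored. -/
def markMove (b : Bool) : Option H → H → Set (Option H × Option (Bool × H))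
  | none, a => {(none, some (b, a)), (some a, none)}
  | some c, _ => {(some c, none)}

theorem track_of_mem_markMove {b b' : Bool} {m m' : Option H} {a : H} {d : Option (Bool × H)}
    (h : (m', d) ∈ markMove b m a) (hb : b ≠ b') : track b' d.toList = [] := by
  cases m with
  | none =>
    obtain h | h := h
    · cases h
      exact track_cons_of_ne hb a []
    · cases h
      rfl
  | some c =>
    cases Set.mem_singleton_iff.1 h
    rfl

theorem Marked.markMove {b : Bool} {m m' : Option H} {p y : List H} {a : H}
    {d : Option (Bool × H)} (h : Marked m p y) (hm : (m', d) ∈ markMove b m a) :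
    Marked m' (p ++ track b d.toList) (y ++ [a]) := by
  obtain ⟨⟨r, rfl⟩, rfl⟩ := h
  cases r with
  | nil =>
    simp only [List.append_nil, List.getElem?_length] at hm ⊢
    obtain hm | hm := hm <;> cases hm <;> simp [Marked, track]
  | cons c r =>
    simp only [List.getElem?_append_right le_rfl, Nat.sub_self, List.getElem?_cons_zero] at hm
    cases Set.mem_singleton_iff.1 hm
    simp [Marked, track]

theorem exists_mem_markMove (b : Bool) (i : ℕ) (y : List H) (a : H) :
    ∃ m d, (m, d) ∈ markMove b y[i]? a ∧ m = (y ++ [a])[i]? ∧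
      y.take i ++ track b d.toList = (y ++ [a]).take i := by
  obtain h | rfl | h := lt_trichotomy i y.length
  · exact ⟨y[i]?, none, by rw [List.getElem?_eq_getElem h]; rfl,
      (List.getElem?_append_left h).symm,
      by rw [List.take_append_of_le_length h.le]; exact List.append_nil _⟩
  · exact ⟨some a, none, by simp [markMove], by simp, by simp [track]⟩
  · have hi : (y ++ [a]).length ≤ i := by simpa using h
    refine ⟨none, some (b, a), ?_, (List.getElem?_eq_none hi).symm, ?_⟩
    · rw [List.getElem?_eq_none h.le]
      exact .inl rfl
    · rw [List.take_of_length_le h.le, List.take_of_length_le hi, Option.toList_some,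
        track_cons_self]
      rfl

/-- `Beats R y z`: at some place where the prefixes of `y` and `z` before it agree, their symbols
(or `none`, after the end of the string) are related by `R`. -/
def Beats (R : Option H → Option H → Prop) (y z : List H) : Prop :=
  ∃ i, y.take i = z.take i ∧ R y[i]? z[i]?

theorem beats_flip {R : Option H → Option H → Prop} {y z : List H} :
    Beats (flip R) y z ↔ Beats R z y :=
  exists_congr fun _ ↦ and_congr_left fun _ ↦ eq_comm

/-- Comparison of the symbols at the first place where two strings differ, for the dictionary order
that comes from `r`; `none` is the end of the string. -/
def lexRel (r : H → H → Prop) : Option H → Option H → Prop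
  | none, some _ => True
  | some a, some b => r a b
  | _, none => False

theorem lex_iff_beats {r : H → H → Prop} {y z : List H} :
    List.Lex r y z ↔ Beats (lexRel r) y z := by
  constructor
  · intro h
    induction h with
    | nil => exact ⟨0, rfl, trivial⟩
    | cons _ ih =>
      obtain ⟨i, hi, hR⟩ := ih
      exact ⟨i + 1, by simp [hi], by simpa using hR⟩
    | rel h => exact ⟨0, rfl, h⟩
  · rintro ⟨i, hi, hR⟩
    induction i generalizing y z with
    | zero =>
      cases y <;> cases z
      exacts [hR.elim, .nil, hR.elim, .rel hR]
    | succ i ih =>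
      cases y <;> cases z
      · exact hR.elim
      · cases hi
      · cases hi
      · obtain ⟨rfl, htl⟩ := List.cons.inj hi
        exact .cons (ih htl (by simpa using hR))

end Marks

section Controllers

variable {S H : Type}

/-- The control that guesses an output `z` with `Beats R y z`, where the input consists of `y`
interleaved with the input of the simulated machine.  It copies `y` and `z` to the two tracks of the
query up to a mark in each; the marks are at the same place after the same prefix if and only if the
two tracks agree. -/
abbrev beatsController (S : Type) {H : Type} [Finite H] (R : Option H → Option H → Prop) :
    Controller S H (S ⊕ H) (Bool × H) Empty where
  C := Option H × Option H
  finC := inferInstance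
  start := (none, none)
  proj := Sum.getLeft?
  onRead c
    | .inl _ => {(c, none)}
    | .inr a => (fun r ↦ ((r.1, c.2), r.2)) '' markMove false c.1 a
  onWrite c a := (fun r ↦ ((c.1, r.1), r.2, none)) '' markMove true c.2 a
  final := {c | R c.1 c.2}

theorem marked_of_reacts_beatsController [Finite H] {R : Option H → Option H → Prop}
    {t : List (S ⊕ H)} {z : List H} {c : (beatsController S R).C} {s : List (Bool × H)}
    {g : List Empty} (h : (beatsController S R).Reacts t z c s g) :
    Marked c.1 (track false s) (t.filterMap Sum.getRight?) ∧ Marked c.2 (track true s) z := by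
  induction h with
  | init => exact ⟨⟨List.prefix_rfl, rfl⟩, ⟨List.prefix_rfl, rfl⟩⟩
  | @onRead t _ _ s _ a _ _ _ hc ih =>
    rw [List.filterMap_append, track_append, track_append]
    cases a with
    | inl a =>
      cases Set.mem_singleton_iff.1 hc
      simpa [track, List.filterMap_cons] using ih
    | inr a =>
      obtain ⟨⟨m, d⟩, hm, hc⟩ := hc
      cases hc
      rw [track_of_mem_markMove hm Bool.false_ne_true, List.append_nil]
      exact ⟨ih.1.markMove hm, ih.2⟩
  | onWrite _ hc ih =>
    obtain ⟨⟨m, d⟩, hm, hc⟩ := hc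
    cases hc
    rw [track_append, track_append, track_of_mem_markMove hm Bool.false_ne_true.symm,
      List.append_nil]
    exact ⟨ih.1, ih.2.markMove hm⟩

theorem beatsController_preservable [Finite H] (R : Option H → Option H → Prop) (i : ℕ) :
    (beatsController S R).Preservable fun t z c s _ ↦
      c = ((t.filterMap Sum.getRight?)[i]?, z[i]?) ∧
        track false s = (t.filterMap Sum.getRight?).take i ∧ track true s = z.take i where
  init := by simp [track]
  onRead := by
    rintro t z _ s _ (a | a) ⟨rfl, hy, hz⟩
    · exact ⟨_, none, rfl, by simp [List.filterMap_cons],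
        by simpa [List.filterMap_cons] using hy, by simpa using hz⟩
    · obtain ⟨m, d, hm, rfl, hd⟩ := exists_mem_markMove false i (t.filterMap Sum.getRight?) a
      refine ⟨_, _, ⟨_, hm, rfl⟩, by simp, ?_, ?_⟩
      · simpa [track_append, hy] using hd
      · rw [track_append, track_of_mem_markMove hm Bool.false_ne_true, List.append_nil, hz]
  onWrite := by
    rintro t z _ s _ a ⟨rfl, hy, hz⟩
    obtain ⟨m, d, hm, rfl, hd⟩ := exists_mem_markMove true i z a
    refine ⟨_, _, _, ⟨_, hm, rfl⟩, rfl, ?_, ?_⟩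
    · rw [track_append, track_of_mem_markMove hm Bool.false_ne_true.symm, List.append_nil, hy]
    · rw [track_append, hz, hd]

/-- The control that copies the input and the output of the simulated machine to the query tape,
and its output also to the output tape. -/
abbrev copyController (S H : Type) : Controller S H S (S ⊕ H) H where
  C := Unit
  finC := inferInstance
  start := ()
  proj := some
  onRead _ a := {((), some (.inl a))}
  onWrite _ a := {((), some (.inr a), some a)}
  final := Set.univ

theorem filterMap_eq_of_reacts_copyController {t : List S} {z : List H}
    {c : (copyController S H).C} {s : List (S ⊕ H)} {g : List H}
    (h : (copyController S H).Reacts t z c s g) :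
    s.filterMap Sum.getLeft? = t ∧ s.filterMap Sum.getRight? = z ∧ g = z := by
  induction h with
  | init => exact ⟨rfl, rfl, rfl⟩
  | onRead _ hc ih =>
    cases Set.mem_singleton_iff.1 hc
    simpa [List.filterMap_cons] using ih
  | onWrite _ hc ih =>
    cases Set.mem_singleton_iff.1 hc
    simpa [List.filterMap_cons] using ih

theorem copyController_preservable :
    (copyController S H).Preservable fun t z c s g ↦ (copyController S H).Reacts t z c s g where
  init := .init
  onRead _ h := ⟨_, _, rfl, h.onRead rfl⟩
  onWrite _ h := ⟨_, _, _, rfl, h.onWrite rfl⟩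

/-- Inputs `x` of `M` interleaved with a string `y` such that `Beats R y z` for some output `z` of
`M` on `x`. -/
def beatenLang (M : NPDA S H) (R : Option H → Option H → Prop) : Language (S ⊕ H) :=
  {t | ∃ z ∈ M.outputs (t.filterMap Sum.getLeft?), Beats R (t.filterMap Sum.getRight?) z}

variable [Finite S] [Finite H] {M : NPDA S H} {R : Option H → Option H → Prop}

theorem accepts_sim_beatsController_iff {t : List (S ⊕ H)} :
    ((beatsController S R).sim M).Accepts (mismatchLang H)ᶜ t ↔ t ∈ beatenLang M R := by
  rw [OracleNPDA.accepts_iff_nonempty_outputs]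
  constructor
  · rintro ⟨g, hg⟩
    obtain ⟨z, c, s, hz, hK, hR, hs⟩ := Controller.exists_of_mem_outputs_sim hg
    obtain ⟨⟨hyp, hy⟩, ⟨hzp, hz'⟩⟩ := marked_of_reacts_beatsController hK
    have htracks : track false s = track true s := not_not.1 hs
    refine ⟨z, hz, (track false s).length, ?_, ?_⟩
    · rw [← List.prefix_iff_eq_take.1 hyp, htracks, ← List.prefix_iff_eq_take.1 hzp]
    · rw [← hy, htracks, ← hz']
      exact hR
  · rintro ⟨z, hz, i, hi, hR⟩
    obtain ⟨_, _, g, -, hg⟩ := Controller.exists_mem_outputs_sim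
      (A := (mismatchLang H)ᶜ) (beatsController_preservable R i) hz (by
        rintro _ s _ ⟨rfl, hy, hz⟩
        exact ⟨hR, fun h ↦ h (hy.trans (hi.trans hz.symm))⟩)
    exact ⟨g, hg⟩

theorem beatenLang_compl_mem_PiCFL (hM : M.Terminates) (R : Option H → Option H → Prop) :
    (⟨S ⊕ H, inferInstance, (beatenLang M R)ᶜ⟩ : Lang) ∈ PiCFL 3 := by
  refine ⟨_, mismatchLang_compl_mem_PiCFL H, (beatsController S R).sim M,
    Controller.sim_terminates hM, fun x ↦ ?_⟩
  change x ∈ (beatenLang M R)ᶜᶜ ↔ _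
  rw [compl_compl]
  exact accepts_sim_beatsController_iff.symm

theorem mem_outputs_sim_copyController_iff {x : List S} {y : List H} :
    y ∈ ((copyController S H).sim M).outputs (beatenLang M R)ᶜ x ↔
      y ∈ M.outputs x ∧ ∀ z ∈ M.outputs x, ¬Beats R y z := by
  have hx : x.filterMap (copyController S H).proj = x := List.filterMap_some
  constructor
  · intro h
    obtain ⟨z, c, s, hz, hK, -, hs⟩ := Controller.exists_of_mem_outputs_sim h
    obtain ⟨rfl, rfl, rfl⟩ := filterMap_eq_of_reacts_copyController hK
    rw [hx] at hz
    exact ⟨hz, fun z hz hb ↦ hs ⟨z, hz, hb⟩⟩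
  · rintro ⟨hy, hb⟩
    obtain ⟨_, s, g, hK, hg⟩ := Controller.exists_mem_outputs_sim
      (A := (beatenLang M R)ᶜ) (t := x) copyController_preservable (hx.symm ▸ hy) (by
        intro _ s g hK
        obtain ⟨rfl, rfl, -⟩ := filterMap_eq_of_reacts_copyController hK
        exact ⟨trivial, fun ⟨z, hz, hz'⟩ ↦ hb z hz hz'⟩)
    obtain ⟨-, -, rfl⟩ := filterMap_eq_of_reacts_copyController hK
    exact hg

end Controllers

theorem mem_SigmaCFLSVt_of_forall_beats {f : MVFun} {M : NPDA f.In f.Out} (hM : M.Terminates)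
    (R : Option f.Out → Option f.Out → Prop)
    (hf : ∀ x, ∃ y, f.val x = {y} ∧ y ∈ M.outputs x ∧
      ∀ z ∈ M.outputs x, (z = y ∨ Beats R z y) ∧ ¬Beats R y z) :
    f ∈ SigmaCFLSVt 4 := by
  have := f.finIn
  have := f.finOut
  refine ⟨⟨⟨_, beatenLang_compl_mem_PiCFL hM R, (copyController f.In f.Out).sim M,
    Controller.sim_terminates hM, fun x ↦ ?_⟩, fun x ↦ ?_⟩, fun x ↦ ?_⟩ <;>
    obtain ⟨y, hy, hmem, hbest⟩ := hf x <;> rw [hy]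
  · ext w
    rw [Set.mem_singleton_iff]
    refine Iff.trans ?_ mem_outputs_sim_copyController_iff.symm
    constructor
    · rintro rfl
      exact ⟨hmem, fun z hz ↦ (hbest z hz).2⟩
    · rintro ⟨hw, hw'⟩
      exact (hbest w hw).1.resolve_right (hw' y hmem)
  · exact Set.subsingleton_singleton
  · exact Set.singleton_nonempty y

theorem OptCFL_subset_SigmaCFLSVt : OptCFL ⊆ SigmaCFLSVt 4 := by
  rintro f ⟨M, hM, hf | hf⟩
  · refine mem_SigmaCFLSVt_of_forall_beats hM (lexRel f.ord.lt) fun x ↦ ?_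
    obtain ⟨y, hy, hmem, hmax⟩ := hf x
    simp only [← lex_iff_beats]
    exact ⟨y, hy, hmem, fun z hz ↦ ⟨hmax z hz, not_lex_of_eq_or_lex _ (hmax z hz)⟩⟩
  · refine mem_SigmaCFLSVt_of_forall_beats hM (flip (lexRel f.ord.lt)) fun x ↦ ?_
    obtain ⟨y, hy, hmem, hmin⟩ := hf x
    simp only [beats_flip, ← lex_iff_beats]
    exact ⟨y, hy, hmem, fun z hz ↦
      ⟨hmin z hz, not_lex_of_eq_or_lex _ ((hmin z hz).imp_left Eq.symm)⟩⟩

theorem CFLSVt_subset_OptCFL : CFLSVt ⊆ OptCFL := by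
  rintro f ⟨⟨⟨M, hM, hf⟩, hsv⟩, htot⟩
  refine ⟨M, hM, .inl fun x ↦ ?_⟩
  obtain ⟨y, hy⟩ := htot x
  exact ⟨y, (hsv x).eq_singleton_of_mem hy, hf x ▸ hy,
    fun z hz ↦ .inl (hsv x ((hf x).symm ▸ hz) hy)⟩

end CFLFun

theorem mainTheorem1 :
    (CFLFun.CFLSVt ⊂ CFLFun.OptCFL ∧ CFLFun.OptCFL ⊆ CFLFun.SigmaCFLSVt 4) ∧
      (CFLFun.maxPalPair ∈ CFLFun.OptCFL ∧ CFLFun.maxPalPair ∉ CFLFun.CFLSVt) := by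
  have hmem := CFLFun.maxPalPair_mem_OptCFL
  have hnot := CFLFun.maxPalPair_notMem_CFLSVt
  exact ⟨⟨⟨CFLFun.CFLSVt_subset_OptCFL, fun h ↦ hnot (h hmem)⟩,
    CFLFun.OptCFL_subset_SigmaCFLSVt⟩, hmem, hnot⟩
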